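/- Let $c\in\mathbb R$. There is an exponent $B=B(c)$ such that for all reals $p>2$, $\gamma$ and $\delta\in(0,1)$ there is a constant $A=A(c,p,\gamma,\delta)$ with the following property. Let $n\ge 2$ and $0\le k\le n$ be integers and $\varepsilon\in(0,1)$. Then there is a randomized linear sketch for vectors $x\in\mathbb Z^n$ with $\|x\|_\infty\le n^{\gamma}$, that is, a random integer matrix $\mathbf S$, determined by uniform random bits and drawn independently of $x$, together with a function that computes an estimate $Z$ from $\mathbf Sx$ and the random bits, which uses at most $$A\cdot\Big(\frac{\log_2 n}{\varepsilon}\Big)^{B}\cdot n^{1-2/p}$$ bits of space (for the random bits and for all the counters $(\mathbf Sx)_j$ together) and has the following guarantee. For $x\in\mathbb Z^n$ let $|a_1|\ge|a_2|\ge\dots\ge|a_n|$ be the absolute values of the coordinates of $x$ in non-increasing order, and let $\|x_{-k}\|_p^p=\sum_{i=k+1}^{n}|a_i|^p$. For every $x\in\mathbb Z^n$ with $\|x\|_\infty\le n^{\gamma}$ such that either $k=0$ or $$|a_k|^p\ \ge\ \Big(\frac{\varepsilon}{\log_2 n}\Big)^{c}\cdot\frac{\|x_{-k}\|_p^p}{k},$$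 the estimate satisfies, with probability at least $1-\delta$, $$\Big|\,Z-\sum_{i=k+1}^{n-k}|a_i|^p\,\Big|\ \le\ \varepsilon\Big(\sum_{i=k+1}^{n-k}|a_i|^p+k\,\big|a_{\lceil k-\varepsilon k\rceil}\big|^p\Big).$$ (The sum is $0$ if $2k\ge n$, and the term $k|a_{\lceil k-\varepsilon k\rceil}|^p$ is $0$ if $k=0$.) -/

import Mathlib

open Finset

/-- `rankedFreq x i` is the `i`-th largest absolute value `|a_i|` among the coordinates of `x`,
with multiplicity and with `i` counted from `1`; it is set to `0` unless `1 ≤ i ≤ n`. -/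
noncomputable def rankedFreq {n : ℕ} (x : Fin n → ℤ) (i : ℕ) : ℝ :=
  if h : 1 ≤ i ∧ i ≤ n then
    |(x (Tuple.sort (fun j => -|x j|) ⟨i - 1, by omega⟩) : ℝ)|
  else 0

/-- The `p`-th moment `‖x_{-k}‖_p^p` of `x` without its `k` largest coordinates. -/
noncomputable def tailMoment {n : ℕ} (x : Fin n → ℤ) (p : ℝ) (k : ℕ) : ℝ :=
  ∑ i ∈ Icc (k + 1) n, rankedFreq x i ^ p

/-- The `p`-th moment of `x` without its `k` largest and its `k` smallest coordinates. -/
noncomputable def trimmedMoment {n : ℕ} (x : Fin n → ℤ) (p : ℝ) (k : ℕ) : ℝ :=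
  ∑ i ∈ Icc (k + 1) (n - k), rankedFreq x i ^ p

/-- A randomized linear sketch of vectors in `ℤ^n`. Uniform random bits (the seed) determine an
integer matrix with `rows` rows; the memory holds the seed and the product of the matrix with the
input vector, one counter of `wordBits` bits per row. At the end an estimate is computed from the
seed and the counters alone. -/
structure LinearSketch (n : ℕ) where
  seedBits : ℕ
  rows : ℕ
  wordBits : ℕ
  matrix : (Fin seedBits → Bool) → Matrix (Fin rows) (Fin n) ℤ
  decode : (Fin seedBits → Bool) → (Fin rows → ℤ) → ℝ

namespace LinearSketch

variable {n : ℕ}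

/-- The number of bits of memory: the stored seed and all counters. -/
def space (S : LinearSketch n) : ℕ := S.seedBits + S.rows * S.wordBits

/-- On input vectors with all coordinates at most `m` in absolute value, no counter ever leaves
the range of signed `wordBits`-bit integers, whatever the seed. -/
def NoOverflow (S : LinearSketch n) (m : ℝ) : Prop :=
  ∀ (seed : Fin S.seedBits → Bool) (x : Fin n → ℤ), (∀ i, |(x i : ℝ)| ≤ m) →
    ∀ j, -(2 : ℤ) ^ S.wordBits ≤ 2 * (S.matrix seed).mulVec x j ∧
      2 * (S.matrix seed).mulVec x j < (2 : ℤ) ^ S.wordBits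

/-- The estimate that the sketch returns on input `x` when its random bits are `seed`. -/
def output (S : LinearSketch n) (seed : Fin S.seedBits → Bool) (x : Fin n → ℤ) : ℝ :=
  S.decode seed ((S.matrix seed).mulVec x)

open Classical in
/-- The probability, over a uniformly random seed, that the estimate returned on input `x`
differs from `v` by at most `err`. -/
noncomputable def probWithin (S : LinearSketch n) (x : Fin n → ℤ) (v err : ℝ) : ℝ :=
  (#{seed : Fin S.seedBits → Bool | |S.output seed x - v| ≤ err} : ℝ) / 2 ^ S.seedBits

end LinearSketch

/-! The sketch is a multi-level CountSketch: pairwise independent nested samples of the coordinates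
at rates `2^{-s}`, each hashed with random signs into `b` buckets, `R` times, where `b` is
`n^{1-2/p}` up to factors polynomial in `log n / ε`. The decoder is not algorithmic: it returns the
trimmed moment of any admissible vector `y` that has the observed counters and for which the seed is
good (`HashSystem.GoodAt`). That a seed is good with high probability is proved for one fixed vector
(`HashSystem.pr_not_goodAt_le`); no union bound over vectors is needed, because the decoder itself
demands it of `y`. It remains to see that two vectors `x`, `y` with the same counters, both good for
the seed, have close trimmed moments.

Let `G` be the larger of the scales `T + k |a_k|^p` of `x` and `y`. If `k v^p ≤ G`, then `O(G /
v^p)` coordinates reach `v`, and by Hölder the squares of the others sum to `O(n^{1-2/p} G^{2/p})`.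
At the first level `s` with `G ≤ 2^s P v^p` the sample has `O(P)` large coordinates, so at every
coordinate most repetitions have noise at most `η v`. A repetition that is quiet for both vectors
gives `|x_i - y_i| ≤ 2 η v` on the sample, and the sampled counts, which are close to the scaled
true counts, compare the number of `|x_i| ≥ v` with that of `|y_i| ≥ v / ρ`
(`HashSystem.countsLe_of_goodAt`). Thresholds with `k v^p > G` are reached by at most `k`
coordinates and do not survive the trimming.

A layer-cake sum over `v = ρ^j` turns close counts into moments that differ by at most `ε G / 16`
(`trimmedMoment_sub_le`). Finally `G` is at most four times the error scale of the theorem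
(`trimmed_close_of_scale_le`); this is where the rank `⌈k - εk⌉` enters. For `2k > n` the trimmed
moment is an empty sum. -/

/-- The number of coordinates of `x` of absolute value at least `v`. -/
noncomputable def freqCount {n : ℕ} (x : Fin n → ℤ) (v : ℝ) : ℕ :=
  #{i | v ≤ |(x i : ℝ)|}

/-! ### Order statistics and threshold counts. -/

section Ranks

variable {n : ℕ} (x : Fin n → ℤ)

theorem rankedFreq_nonneg (i : ℕ) : 0 ≤ rankedFreq x i := by
  unfold rankedFreq; split_ifs <;> positivity

theorem rankedFreq_eq_sort {i : ℕ} (h1 : 1 ≤ i) (hn : i ≤ n) :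
    rankedFreq x i = |(x (Tuple.sort (fun j => -|x j|) ⟨i - 1, by omega⟩) : ℝ)| :=
  dif_pos ⟨h1, hn⟩

theorem abs_sort_antitone :
    Antitone fun t : Fin n => |(x (Tuple.sort (fun j => -|x j|) t) : ℝ)| := by
  intro a b hab
  have h := Tuple.monotone_sort (fun j => -|x j|) hab
  simp only [Function.comp_apply, neg_le_neg_iff] at h
  simpa only [← Int.cast_abs] using (Int.cast_le (R := ℝ)).2 h

theorem freqCount_eq_sort (v : ℝ) :
    freqCount x v = #{t : Fin n | v ≤ |(x (Tuple.sort (fun j => -|x j|) t) : ℝ)|} := by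
  unfold freqCount
  symm
  apply card_bij (fun t _ => Tuple.sort (fun j => -|x j|) t)
  · intro t ht; simpa using ht
  · intro a _ b _ h; exact (Tuple.sort _).injective h
  · intro b hb
    exact ⟨(Tuple.sort (fun j => -|x j|)).symm b, by simpa using hb, by simp⟩

/-- Ranks and counts are inverse to each other, ties included. From here on order statistics are
handled through counts, which can be estimated by sampling. -/
theorem le_rankedFreq_iff {i : ℕ} (h1 : 1 ≤ i) (hn : i ≤ n) (v : ℝ) :
    v ≤ rankedFreq x i ↔ i ≤ freqCount x v := by
  rw [rankedFreq_eq_sort x h1 hn, freqCount_eq_sort]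
  constructor
  · intro h
    calc i = #(Finset.Iic (⟨i - 1, by omega⟩ : Fin n)) := by simp; omega
      _ ≤ _ := by
        apply card_le_card
        intro t ht
        simp only [mem_Iic] at ht
        simp only [mem_filter, mem_univ, true_and]
        exact h.trans (abs_sort_antitone x ht)
  · intro h
    by_contra hv
    have : #{t : Fin n | v ≤ |(x (Tuple.sort (fun j => -|x j|) t) : ℝ)|} ≤
        #(Finset.Iio (⟨i - 1, by omega⟩ : Fin n)) := by
      apply card_le_card
      intro t ht
      simp only [mem_filter, mem_univ, true_and] at ht
      simp only [mem_Iio]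
      by_contra hlt
      exact hv (ht.trans (abs_sort_antitone x (not_lt.1 hlt)))
    simp at this
    omega

theorem rankedFreq_antitone {i j : ℕ} (h1 : 1 ≤ i) (hij : i ≤ j) (hn : j ≤ n) :
    rankedFreq x j ≤ rankedFreq x i := by
  rw [le_rankedFreq_iff x h1 (hij.trans hn)]
  exact hij.trans ((le_rankedFreq_iff x (h1.trans hij) hn _).1 le_rfl)

theorem freqCount_le (v : ℝ) : freqCount x v ≤ n := by
  simpa [freqCount] using card_filter_le (univ : Finset (Fin n)) fun i => v ≤ |(x i : ℝ)|

theorem freqCount_anti {u v : ℝ} (h : u ≤ v) : freqCount x v ≤ freqCount x u := by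
  apply card_le_card
  intro i hi
  simp only [mem_filter, mem_univ, true_and] at hi ⊢
  exact h.trans hi

theorem sum_rankedFreq (f : ℝ → ℝ) :
    ∑ i ∈ Icc 1 n, f (rankedFreq x i) = ∑ i, f |(x i : ℝ)| := by
  rw [← Equiv.sum_comp (Tuple.sort (fun j => -|x j|)) (fun i => f |(x i : ℝ)|)]
  symm
  apply sum_bij (fun (t : Fin n) _ => (t : ℕ) + 1)
  · intro t _; simp only [mem_Icc]; omega
  · intro a _ b _ h; exact Fin.ext (by simpa using h)
  · intro b hb
    simp only [mem_Icc] at hb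
    exact ⟨⟨b - 1, by omega⟩, mem_univ _, by simp; omega⟩
  · intro t _
    rw [rankedFreq_eq_sort x (by omega) (by omega)]
    simp

theorem card_filter_rankedFreq (a b : ℕ) (hb : b ≤ n) (v : ℝ) :
    #{i ∈ Icc (a + 1) b | v ≤ rankedFreq x i} = min (freqCount x v) b - a := by
  have : {i ∈ Icc (a + 1) b | v ≤ rankedFreq x i} = Icc (a + 1) (min (freqCount x v) b) := by
    ext i
    simp only [mem_filter, mem_Icc, le_min_iff]
    constructor
    · rintro ⟨⟨h1, h2⟩, h3⟩
      exact ⟨h1, (le_rankedFreq_iff x (by omega) (by omega) v).1 h3, h2⟩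
    · rintro ⟨h1, h2, h3⟩
      exact ⟨⟨h1, h3⟩, (le_rankedFreq_iff x (by omega) (by omega) v).2 h2⟩
  rw [this, Nat.card_Icc]; omega

theorem rankedFreq_le {M : ℝ} (hM : 0 ≤ M) (h : ∀ i, |(x i : ℝ)| ≤ M) (i : ℕ) :
    rankedFreq x i ≤ M := by
  unfold rankedFreq; split_ifs
  · exact h _
  · exact hM

end Ranks

/-! ### Bounds on counts and on the energy of small coordinates in terms of the scale. -/

section Scale

variable {n : ℕ} (x : Fin n → ℤ) (p : ℝ) (k : ℕ)

/-- The scale `T + k |a_k|^p` of a vector with trimmed moment `T`; it dominates the moment of the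
vector without its `k` largest coordinates. -/
noncomputable def trimmedScale : ℝ := trimmedMoment x p k + k * rankedFreq x k ^ p

theorem trimmedMoment_nonneg : 0 ≤ trimmedMoment x p k :=
  sum_nonneg fun _ _ => Real.rpow_nonneg (rankedFreq_nonneg x _) _

theorem trimmedMoment_le_scale : trimmedMoment x p k ≤ trimmedScale x p k :=
  le_add_of_nonneg_right (mul_nonneg (Nat.cast_nonneg _) (Real.rpow_nonneg (rankedFreq_nonneg x _) _))

theorem rankedFreq_le_scale : k * rankedFreq x k ^ p ≤ trimmedScale x p k :=
  le_add_of_nonneg_left (trimmedMoment_nonneg x p k)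

variable {p k}

/-- The `k` smallest coordinates, which the trimmed moment omits, are each at most `|a_k|`. -/
theorem tailMoment_le_scale (hp : 0 ≤ p) (hk : 2 * k ≤ n) :
    tailMoment x p k ≤ trimmedScale x p k := by
  have hsplit : tailMoment x p k =
      trimmedMoment x p k + ∑ i ∈ Icc (n - k + 1) n, rankedFreq x i ^ p := by
    unfold tailMoment trimmedMoment
    rw [← sum_union]
    · congr 1; ext i; simp only [mem_Icc, mem_union]; omega
    · rw [disjoint_left]; intro i; simp only [mem_Icc]; omega
  rw [hsplit, trimmedScale]
  gcongr
  calc ∑ i ∈ Icc (n - k + 1) n, rankedFreq x i ^ p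
      ≤ ∑ i ∈ Icc (n - k + 1) n, rankedFreq x k ^ p := by
        apply sum_le_sum
        intro i hi
        simp only [mem_Icc] at hi
        apply Real.rpow_le_rpow (rankedFreq_nonneg x i) _ hp
        exact rankedFreq_antitone x (by omega) (by omega) hi.2
    _ = k * rankedFreq x k ^ p := by
        rw [sum_const, Nat.card_Icc, nsmul_eq_mul]
        congr 2; omega

theorem sum_Icc_split (f : ℕ → ℝ) (hk : k ≤ n) :
    ∑ i ∈ Icc 1 n, f i = ∑ i ∈ Icc 1 k, f i + ∑ i ∈ Icc (k + 1) n, f i := by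
  rw [← sum_union]
  · congr 1; ext i; simp only [mem_Icc, mem_union]; omega
  · rw [disjoint_left]; intro i; simp only [mem_Icc]; omega

theorem freqCount_le_scale (hp : 0 ≤ p) (hk : 2 * k ≤ n) {v : ℝ} (hv : 0 < v) :
    freqCount x v ≤ k + trimmedScale x p k / v ^ p := by
  have hvp : 0 < v ^ p := Real.rpow_pos_of_pos hv p
  have h1 : (freqCount x v : ℝ) ≤ k + #{i ∈ Icc (k + 1) n | v ≤ rankedFreq x i} := by
    rw [card_filter_rankedFreq x k n le_rfl v, min_eq_left (freqCount_le x v)]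
    norm_cast; omega
  refine h1.trans (add_le_add le_rfl ?_)
  rw [le_div_iff₀ hvp]
  refine le_trans ?_ (tailMoment_le_scale x hp hk)
  unfold tailMoment
  rw [← nsmul_eq_mul, ← sum_const]
  refine le_trans (sum_le_sum (g := fun i => rankedFreq x i ^ p) ?_)
    (sum_le_sum_of_subset_of_nonneg (filter_subset _ _)
      fun i _ _ => Real.rpow_nonneg (rankedFreq_nonneg x i) p)
  intro i hi
  exact Real.rpow_le_rpow hv.le (mem_filter.1 hi).2 hp

theorem sum_light_rpow_le_scale (hp : 0 < p) (hk : 2 * k ≤ n) {v : ℝ} (hv : 0 < v) :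
    ∑ i with |(x i : ℝ)| < v, |(x i : ℝ)| ^ p ≤ k * v ^ p + trimmedScale x p k := by
  rw [sum_filter, ← sum_rankedFreq x (fun a => if a < v then a ^ p else 0),
    sum_Icc_split (k := k) _ (by omega)]
  apply add_le_add
  · calc _ ≤ ∑ i ∈ Icc 1 k, v ^ p := by
          apply sum_le_sum
          intro i _
          split_ifs with h
          · exact Real.rpow_le_rpow (rankedFreq_nonneg x i) h.le hp.le
          · positivity
      _ = _ := by simp
  · refine le_trans (sum_le_sum fun i _ => ?_) (tailMoment_le_scale x hp.le hk)
    split_ifs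
    · exact le_rfl
    · exact Real.rpow_nonneg (rankedFreq_nonneg x i) p

/-- Hölder's inequality against the constant `1`, with exponents `p / (p - 2)` and `p / 2`. The
factor `n^{1-2/p}` in the space bound originates here. -/
theorem sum_light_sq_le (hp : 2 < p) (hk : 2 * k ≤ n) {v G : ℝ} (hv : 0 < v)
    (hG : trimmedScale x p k ≤ G) (hkG : k * v ^ p ≤ G) :
    ∑ i with |(x i : ℝ)| < v, (x i : ℝ) ^ 2 ≤ (n : ℝ) ^ (1 - 2 / p) * (2 * G) ^ (2 / p) := by
  have hp0 : 0 < p := by linarith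
  have hl := sum_light_rpow_le_scale x hp0 hk hv
  set A : Finset (Fin n) := {i | |(x i : ℝ)| < v}
  have hA0 : 0 ≤ ∑ i ∈ A, |(x i : ℝ)| ^ p := by positivity
  have hold := Real.inner_le_Lp_mul_Lq A (fun _ => (1 : ℝ)) (fun i => |(x i : ℝ)| ^ 2)
    (p := p / (p - 2)) (q := p / 2)
    (by
      rw [Real.holderConjugate_iff]
      constructor
      · rw [lt_div_iff₀ (by linarith)]; linarith
      · rw [inv_div, inv_div]; field_simp; ring)
  simp only [one_mul, abs_one, Real.one_rpow, sum_const, nsmul_eq_mul, mul_one, sq_abs, one_div,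
    inv_div] at hold
  have he : ∀ i, |(x i : ℝ) ^ 2| ^ (p / 2) = |(x i : ℝ)| ^ p := by
    intro i
    rw [abs_pow, ← Real.rpow_natCast, ← Real.rpow_mul (abs_nonneg _)]
    congr 1; push_cast; ring
  simp only [he] at hold
  refine hold.trans ?_
  have h2 : (p - 2) / p = 1 - 2 / p := by field_simp
  rw [h2]
  have hexp : 0 ≤ 1 - 2 / p := by rw [← h2]; apply div_nonneg <;> linarith
  apply mul_le_mul _ _ (by positivity) (by positivity)
  · apply Real.rpow_le_rpow (by positivity) _ hexp
    exact_mod_cast (card_le_univ A).trans (by simp)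
  · exact Real.rpow_le_rpow hA0 (by linarith) (by positivity)

theorem trimmedScale_le (hp : 0 ≤ p) {M : ℝ} (hM : 0 ≤ M)
    (h : ∀ i, |(x i : ℝ)| ≤ M) (hk : 2 * k ≤ n) : trimmedScale x p k ≤ n * M ^ p := by
  have hM' : ∀ i, rankedFreq x i ^ p ≤ M ^ p := fun i =>
    Real.rpow_le_rpow (rankedFreq_nonneg x i) (rankedFreq_le x hM h i) hp
  unfold trimmedScale trimmedMoment
  calc _ ≤ ∑ i ∈ Icc (k + 1) (n - k), M ^ p + k * M ^ p := by
        exact add_le_add (sum_le_sum fun i _ => hM' i)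
          (mul_le_mul_of_nonneg_left (hM' k) (Nat.cast_nonneg k))
    _ = ((n - k - k : ℕ) + k : ℝ) * M ^ p := by
        rw [sum_const, Nat.card_Icc, nsmul_eq_mul, add_mul]
        congr 3; omega
    _ ≤ n * M ^ p := by
        gcongr
        norm_cast; omega

end Scale

/-! ### Discrete layer-cake formula for `a^p` over geometric thresholds. -/

section LayerCake

/-- The increments of the sequence `0, 1, u, u ^ 2, …`. -/
noncomputable def powIncrement (u : ℝ) : ℕ → ℝ
  | 0 => 1
  | j + 1 => u ^ (j + 1) - u ^ j

theorem sum_powIncrement (u : ℝ) (J : ℕ) : ∑ j ∈ range (J + 1), powIncrement u j = u ^ J := by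
  induction J with
  | zero => simp [powIncrement]
  | succ J ih => rw [sum_range_succ, ih, powIncrement]; ring

theorem powIncrement_nonneg {u : ℝ} (hu : 1 ≤ u) (j : ℕ) : 0 ≤ powIncrement u j := by
  cases j with
  | zero => simp [powIncrement]
  | succ j => exact sub_nonneg.2 (pow_le_pow_right₀ hu (Nat.le_succ j))

theorem powIncrement_le {u : ℝ} (hu : 1 ≤ u) (j : ℕ) : powIncrement u j ≤ u ^ j := by
  cases j with
  | zero => simp [powIncrement]
  | succ j => exact sub_le_self _ (by positivity)

variable {ρ p a : ℝ}

theorem pow_rpow_comm (hρ : 0 ≤ ρ) (j : ℕ) : (ρ ^ p) ^ j = (ρ ^ j) ^ p := by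
  rw [← Real.rpow_natCast, ← Real.rpow_natCast, ← Real.rpow_mul hρ, ← Real.rpow_mul hρ, mul_comm]

theorem sum_layers_eq (hρ : 1 ≤ ρ) {J : ℕ} (h : ρ ^ J ≤ a) :
    ∑ j ∈ range (J + 1), (if ρ ^ j ≤ a then powIncrement (ρ ^ p) j else 0) = (ρ ^ J) ^ p := by
  rw [← pow_rpow_comm (by linarith), ← sum_powIncrement]
  apply sum_congr rfl
  intro j hj
  rw [if_pos ((pow_le_pow_right₀ hρ (by simpa [Nat.lt_succ_iff] using hj)).trans h)]

theorem sum_layers_le (hρ : 1 ≤ ρ) (hp : 0 ≤ p) (ha : 0 ≤ a) (J : ℕ) :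
    ∑ j ∈ range J, (if ρ ^ j ≤ a then powIncrement (ρ ^ p) j else 0) ≤ a ^ p := by
  induction J with
  | zero => simpa using Real.rpow_nonneg ha p
  | succ J ih =>
    by_cases h : ρ ^ J ≤ a
    · rw [sum_layers_eq hρ h]
      exact Real.rpow_le_rpow (by positivity) h hp
    · rwa [sum_range_succ, if_neg h, add_zero]

/-- The sum telescopes to the `p`-th power of the largest threshold below `a`, and rounding down to
it costs at most a factor `ρ`. The assumption `1 ≤ a` suits nonzero integers. -/
theorem rpow_le_sum_layers (hρ : 1 ≤ ρ) (hp : 0 ≤ p) (ha : 1 ≤ a) {J : ℕ} (haJ : a < ρ ^ J) :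
    a ^ p ≤ ρ ^ p * ∑ j ∈ range J, (if ρ ^ j ≤ a then powIncrement (ρ ^ p) j else 0) := by
  induction J with
  | zero => simp at haJ; linarith
  | succ J ih =>
    by_cases h : ρ ^ J ≤ a
    · rw [sum_layers_eq hρ h, ← Real.mul_rpow (by positivity) (by positivity), ← pow_succ']
      exact Real.rpow_le_rpow (by positivity) haJ.le hp
    · rw [sum_range_succ, if_neg h, add_zero]
      exact ih (not_le.1 h)

end LayerCake

theorem rankedFreq_eq_zero_or_one_le {n : ℕ} (x : Fin n → ℤ) (i : ℕ) :
    rankedFreq x i = 0 ∨ 1 ≤ rankedFreq x i := by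
  unfold rankedFreq
  split_ifs
  · rw [← Int.cast_abs]
    rcases (abs_nonneg (x (Tuple.sort (fun j => -|x j|) ⟨i - 1, by omega⟩))).eq_or_lt with h | h
    · left; rw [← h]; simp
    · right; exact_mod_cast h
  · exact Or.inl rfl

/-! ### From close counts to close trimmed moments. -/

section Compare

variable {n k J : ℕ} {x y : Fin n → ℤ} {p ρ κ G : ℝ}

/-- The rank counts of `x` at the thresholds `1, ρ, ρ ^ 2, …` are at most those of `y` at
thresholds smaller by the factor `ρ`, up to an error of relative size `κ` at scale `G`. -/
def CountsLe (k J : ℕ) (p ρ κ G : ℝ) (x y : Fin n → ℤ) : Prop :=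
  ∀ j < J, k * (ρ ^ j) ^ p ≤ G →
    (freqCount x (ρ ^ j) : ℝ) ≤ freqCount y (ρ ^ j / ρ) + κ * G / (ρ ^ j) ^ p

/-- Trimming is what allows `CountsLe` to ignore large thresholds: if `k (ρ^j)^p > G`, then `|a_k| <
ρ^j`, and no coordinate of rank above `k` is counted. -/
theorem trimmed_count_le (hp : 0 < p) (hρ : 1 < ρ) (hκ : 0 ≤ κ) (hk : 2 * k ≤ n) (hG : 0 < G)
    (hGx : trimmedScale x p k ≤ G) (h : CountsLe k J p ρ κ G x y) {j : ℕ} (hj : j < J) :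
    (#{i ∈ Icc (k + 1) (n - k) | ρ ^ j ≤ rankedFreq x i} : ℝ) ≤
      #{i ∈ Icc (k + 1) (n - k) | ρ ^ j / ρ ≤ rankedFreq y i} + κ * G / (ρ ^ j) ^ p := by
  have hρ0 : 0 < ρ := by linarith
  rw [card_filter_rankedFreq x k (n - k) (by omega), card_filter_rankedFreq y k (n - k) (by omega)]
  have hpos : 0 ≤ κ * G / (ρ ^ j) ^ p := by positivity
  by_cases hkG : k * (ρ ^ j) ^ p ≤ G
  · have h1 := h j hj hkG
    set e := κ * G / (ρ ^ j) ^ p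
    -- Counts are integers, so the error may be rounded down; cutting off at `n - k` and subtracting
    -- `k` in `ℕ` then does not increase the difference.
    have h2 : freqCount x (ρ ^ j) ≤ freqCount y (ρ ^ j / ρ) + ⌊e⌋₊ := by
      rw [add_comm, ← Nat.floor_add_natCast hpos, add_comm]
      exact Nat.le_floor h1
    have h3 : min (freqCount x (ρ ^ j)) (n - k) - k ≤
        min (freqCount y (ρ ^ j / ρ)) (n - k) - k + ⌊e⌋₊ := by omega
    calc _ ≤ ((min (freqCount y (ρ ^ j / ρ)) (n - k) - k + ⌊e⌋₊ : ℕ) : ℝ) := by exact_mod_cast h3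
      _ ≤ _ := by push_cast; gcongr; exact Nat.floor_le hpos
  · have : freqCount x (ρ ^ j) ≤ k := by
      by_contra hc
      have hk1 : 1 ≤ k := by
        by_contra hk0
        apply hkG
        have : k = 0 := by omega
        subst this
        simpa using hG.le
      apply hkG
      refine le_trans ?_ ((rankedFreq_le_scale x p k).trans hGx)
      gcongr
      rw [le_rankedFreq_iff x hk1 (by omega)]
      omega
    have : min (freqCount x (ρ ^ j)) (n - k) - k = 0 := by omega
    rw [this, Nat.cast_zero]
    positivity

/-- One factor `ρ^p` pays for rounding the values of `x` to thresholds, the other for the shift of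
the thresholds of `y`. The error `κ G / (ρ^j)^p` times the increment is at most `κ G`, so each of
the `J` thresholds contributes the same bound. -/
theorem trimmedMoment_le_of_countsLe (hp : 0 < p) (hρ : 1 < ρ) (hκ : 0 ≤ κ) (hk : 2 * k ≤ n)
    (hG : 0 < G) (hGx : trimmedScale x p k ≤ G) (hJ : ∀ i, |(x i : ℝ)| < ρ ^ J)
    (h : CountsLe k J p ρ κ G x y) :
    trimmedMoment x p k ≤ ρ ^ p * (ρ ^ p * trimmedMoment y p k + J * (κ * G)) := by
  have hρ0 : 0 < ρ := by linarith
  have hu : 1 ≤ ρ ^ p := Real.one_le_rpow hρ.le hp.le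
  have hxJ : ∀ i, rankedFreq x i < ρ ^ J := by
    intro i
    unfold rankedFreq
    split_ifs
    · exact hJ _
    · positivity
  have h1 : trimmedMoment x p k ≤ ρ ^ p * ∑ j ∈ range J, powIncrement (ρ ^ p) j *
      #{i ∈ Icc (k + 1) (n - k) | ρ ^ j ≤ rankedFreq x i} := by
    calc trimmedMoment x p k ≤ ∑ i ∈ Icc (k + 1) (n - k), ρ ^ p * ∑ j ∈ range J,
          (if ρ ^ j ≤ rankedFreq x i then powIncrement (ρ ^ p) j else 0) := by
          apply sum_le_sum
          intro i _
          rcases rankedFreq_eq_zero_or_one_le x i with h0 | h0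
          · rw [h0, Real.zero_rpow hp.ne']
            refine mul_nonneg (by positivity) (sum_nonneg fun j _ => ?_)
            split_ifs
            exacts [powIncrement_nonneg hu j, le_rfl]
          · exact rpow_le_sum_layers hρ.le hp.le h0 (hxJ i)
      _ = _ := by
          rw [← mul_sum, sum_comm]
          congr 1
          refine sum_congr rfl fun j _ => ?_
          rw [← sum_filter, sum_const, nsmul_eq_mul, mul_comm]
  refine h1.trans (mul_le_mul_of_nonneg_left ?_ (by positivity))
  calc _ ≤ ∑ j ∈ range J, (powIncrement (ρ ^ p) j *
        #{i ∈ Icc (k + 1) (n - k) | ρ ^ j / ρ ≤ rankedFreq y i} + κ * G) := by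
        apply sum_le_sum
        intro j hj
        have h2 := trimmed_count_le hp hρ hκ hk hG hGx h (mem_range.1 hj)
        have h3 := mul_le_mul_of_nonneg_left h2 (powIncrement_nonneg hu j)
        rw [mul_add] at h3
        refine h3.trans (add_le_add le_rfl ?_)
        rw [mul_div_assoc', div_le_iff₀ (by positivity), mul_comm, ← pow_rpow_comm hρ0.le]
        exact mul_le_mul_of_nonneg_left (powIncrement_le hu j) (by positivity)
    _ = ∑ i ∈ Icc (k + 1) (n - k), ∑ j ∈ range J,
          (if ρ ^ j ≤ ρ * rankedFreq y i then powIncrement (ρ ^ p) j else 0) + J * (κ * G) := by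
        rw [sum_add_distrib, sum_const, card_range, nsmul_eq_mul, sum_comm]
        congr 1
        refine sum_congr rfl fun j _ => ?_
        rw [← sum_filter, sum_const, nsmul_eq_mul, mul_comm]
        simp only [div_le_iff₀ hρ0, mul_comm ρ]
    _ ≤ _ := by
        unfold trimmedMoment
        rw [mul_sum]
        gcongr with i
        rw [← Real.mul_rpow hρ0.le (rankedFreq_nonneg y i)]
        exact sum_layers_le hρ.le hp.le (mul_nonneg hρ0.le (rankedFreq_nonneg y i)) J

variable {ε : ℝ}

theorem trimmedMoment_sub_le (hp : 0 < p) (hρ : 1 < ρ) (hκ : 0 ≤ κ) (hk : 2 * k ≤ n)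
    (hG : 0 < G) (hGx : trimmedScale x p k ≤ G) (hGy : trimmedScale y p k ≤ G)
    (hJ : ∀ i, |(x i : ℝ)| < ρ ^ J) (h : CountsLe k J p ρ κ G x y)
    (hε1 : ε ≤ 1) (hρε : (ρ ^ p) ^ 2 ≤ 1 + ε / 32) (hκε : J * κ ≤ ε / 64) :
    trimmedMoment x p k - trimmedMoment y p k ≤ ε / 16 * G := by
  have h1 := trimmedMoment_le_of_countsLe hp hρ hκ hk hG hGx hJ h
  have hu : 1 ≤ ρ ^ p := Real.one_le_rpow hρ.le hp.le
  have hu2 : ρ ^ p ≤ 2 := by nlinarith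
  have hT := trimmedMoment_nonneg y p k
  have hTG := (trimmedMoment_le_scale y p k).trans hGy
  have hε0 : 0 ≤ ε := by nlinarith
  have e1 : (ρ ^ p) ^ 2 * trimmedMoment y p k ≤ trimmedMoment y p k + ε / 32 * G := by
    nlinarith
  have e2 : ρ ^ p * (J * (κ * G)) ≤ ε / 32 * G := by
    have : 0 ≤ J * (κ * G) := by positivity
    nlinarith
  nlinarith

/-- Either the trimmed moment makes up half of the scale of `y`, and then that of `x` is comparable,
or `k |b_k|^p` does for the `k`-th largest `|b_k|` of `y`. In the latter case the counting error at
a threshold just below `|b_k|` is at most `ε k`, so at least `k - ε k` coordinates of `x` nearly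
reach it. -/
theorem trimmed_close_of_scale_le (hp : 0 < p) (hρ : 1 < ρ) (hκ : 0 ≤ κ) (hk : 2 * k ≤ n)
    (hxy : trimmedScale x p k ≤ trimmedScale y p k) (hG : 0 < trimmedScale y p k)
    (hJy : ∀ i, |(y i : ℝ)| < ρ ^ J)
    (hyx : CountsLe k J p ρ κ (trimmedScale y p k) y x)
    (hε0 : 0 < ε) (hε1 : ε < 1) (hρε : (ρ ^ p) ^ 2 ≤ 1 + ε / 32) (hκε : J * κ ≤ ε / 64) :
    trimmedScale y p k ≤
      4 * (trimmedMoment x p k + k * rankedFreq x ⌈(k : ℝ) - ε * k⌉₊ ^ p) := by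
  have hρ0 : 0 < ρ := by linarith
  have hu : 1 ≤ ρ ^ p := Real.one_le_rpow hρ.le hp.le
  have hu2 : ρ ^ p ≤ 2 := by nlinarith
  set G := trimmedScale y p k with hGdef
  have hQ : 0 ≤ k * rankedFreq x ⌈(k : ℝ) - ε * k⌉₊ ^ p :=
    mul_nonneg (Nat.cast_nonneg _) (Real.rpow_nonneg (rankedFreq_nonneg x _) _)
  have hT := trimmedMoment_nonneg x p k
  have h1 := trimmedMoment_sub_le hp hρ hκ hk hG le_rfl hxy hJy hyx hε1.le hρε hκε
  by_cases hc : G / 2 ≤ trimmedMoment y p k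
  · nlinarith
  have hkG : G / 2 < k * rankedFreq y k ^ p := by
    have : G = trimmedMoment y p k + k * rankedFreq y k ^ p := hGdef
    linarith
  have hk1 : 1 ≤ k := by
    by_contra h0
    have : k = 0 := by omega
    subst this
    simp at hkG; linarith
  have hkpos : (0 : ℝ) < k := by exact_mod_cast hk1
  set v := rankedFreq y k with hv
  have hv1 : 1 ≤ v := by
    rcases rankedFreq_eq_zero_or_one_le y k with h0 | h0
    · rw [← hv] at h0
      rw [h0, Real.zero_rpow hp.ne', mul_zero] at hkG; linarith
    · exact h0
  obtain ⟨j, hj1, hj2⟩ := exists_nat_pow_near hv1 hρ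
  have hvJ : v < ρ ^ J := by
    rw [hv, rankedFreq_eq_sort y hk1 (by omega)]; exact hJy _
  have hjJ : j < J := by
    by_contra hcon
    exact absurd (hj1.trans_lt hvJ) (not_lt.2 (pow_le_pow_right₀ hρ.le (not_lt.1 hcon)))
  have hjp : 0 < (ρ ^ j) ^ p := by positivity
  have hvp : v ^ p ≤ ρ ^ p * (ρ ^ j) ^ p := by
    rw [← Real.mul_rpow hρ0.le (by positivity), ← pow_succ']
    exact Real.rpow_le_rpow (by linarith) hj2.le hp.le
  have h2 := hyx j hjJ (by
    refine le_trans ?_ (rankedFreq_le_scale y p k)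
    gcongr)
  have h3 : k ≤ freqCount y (ρ ^ j) := (le_rankedFreq_iff y hk1 (by omega) _).1 hj1
  have hJ1 : (1 : ℝ) ≤ J := by exact_mod_cast (by omega : 1 ≤ J)
  have hκ1 : κ ≤ ε / 64 := by nlinarith
  have h4 : κ * G / (ρ ^ j) ^ p ≤ ε * k := by
    rw [div_le_iff₀ hjp]
    have hG2 : G ≤ 4 * (k * (ρ ^ j) ^ p) := by
      have a1 : k * v ^ p ≤ k * (2 * (ρ ^ j) ^ p) := by
        gcongr; exact hvp.trans (by gcongr)
      linarith
    have hpos : 0 < k * (ρ ^ j) ^ p := by positivity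
    calc κ * G ≤ ε / 64 * (4 * (k * (ρ ^ j) ^ p)) := by gcongr
      _ ≤ _ := by nlinarith
  have h5 : ⌈(k : ℝ) - ε * k⌉₊ ≤ freqCount x (ρ ^ j / ρ) := by
    rw [Nat.ceil_le]
    have : (k : ℝ) ≤ freqCount y (ρ ^ j) := by exact_mod_cast h3
    linarith
  have hceil1 : 1 ≤ ⌈(k : ℝ) - ε * k⌉₊ := by
    rw [Nat.one_le_ceil_iff]; nlinarith
  have hceilk : ⌈(k : ℝ) - ε * k⌉₊ ≤ k := by
    rw [Nat.ceil_le]; nlinarith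
  have h6 := (le_rankedFreq_iff x hceil1 (by omega) _).2 h5
  set w := rankedFreq x ⌈(k : ℝ) - ε * k⌉₊
  have h7 : (ρ ^ j) ^ p ≤ ρ ^ p * w ^ p := by
    rw [← Real.mul_rpow hρ0.le (rankedFreq_nonneg x _)]
    apply Real.rpow_le_rpow (by positivity) _ hp.le
    rwa [div_le_iff₀' hρ0] at h6
  have hw : 0 ≤ w ^ p := Real.rpow_nonneg (rankedFreq_nonneg x _) _
  have h8 : v ^ p ≤ 2 * w ^ p := by
    calc v ^ p ≤ ρ ^ p * (ρ ^ p * w ^ p) := hvp.trans (by gcongr)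
      _ = (ρ ^ p) ^ 2 * w ^ p := by ring
      _ ≤ 2 * w ^ p := by gcongr; linarith
  have h9 : k * v ^ p ≤ k * (2 * w ^ p) := by gcongr
  linarith

/-- Vectors whose rank counts agree up to small errors have nearly the same trimmed moments. -/
theorem trimmed_close (hp : 0 < p) (hρ : 1 < ρ) (hκ : 0 ≤ κ) (hk : 2 * k ≤ n)
    (hJx : ∀ i, |(x i : ℝ)| < ρ ^ J) (hJy : ∀ i, |(y i : ℝ)| < ρ ^ J)
    (h : ∀ G, 0 < G → trimmedScale x p k ≤ G → trimmedScale y p k ≤ G →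
      (trimmedScale x p k = G ∨ trimmedScale y p k = G) →
      CountsLe k J p ρ κ G x y ∧ CountsLe k J p ρ κ G y x)
    (hε0 : 0 < ε) (hε1 : ε < 1) (hρε : (ρ ^ p) ^ 2 ≤ 1 + ε / 32) (hκε : J * κ ≤ ε / 64) :
    |trimmedMoment y p k - trimmedMoment x p k| ≤
      ε * (trimmedMoment x p k + k * rankedFreq x ⌈(k : ℝ) - ε * k⌉₊ ^ p) := by
  have hQ : 0 ≤ k * rankedFreq x ⌈(k : ℝ) - ε * k⌉₊ ^ p :=
    mul_nonneg (Nat.cast_nonneg _) (Real.rpow_nonneg (rankedFreq_nonneg x _) _)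
  have hTx := trimmedMoment_nonneg x p k
  have hTy := trimmedMoment_nonneg y p k
  set G := max (trimmedScale x p k) (trimmedScale y p k) with hGdef
  have hGx : trimmedScale x p k ≤ G := le_max_left _ _
  have hGy : trimmedScale y p k ≤ G := le_max_right _ _
  have hTxG := (trimmedMoment_le_scale x p k).trans hGx
  have hTyG := (trimmedMoment_le_scale y p k).trans hGy
  rcases (hTx.trans hTxG).eq_or_lt with h0 | hG
  -- If `G = 0`, both trimmed moments vanish.
  · have e1 : trimmedMoment x p k = 0 := by linarith
    have e2 : trimmedMoment y p k = 0 := by linarith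
    rw [e1, e2, sub_zero, abs_zero, zero_add]
    positivity
  have hor : trimmedScale x p k = G ∨ trimmedScale y p k = G := by
    rcases max_choice (trimmedScale x p k) (trimmedScale y p k) with h | h
    · exact Or.inl h.symm
    · exact Or.inr h.symm
  obtain ⟨hxy, hyx⟩ := h G hG hGx hGy hor
  have d1 := trimmedMoment_sub_le hp hρ hκ hk hG hGx hGy hJx hxy hε1.le hρε hκε
  have d2 := trimmedMoment_sub_le hp hρ hκ hk hG hGy hGx hJy hyx hε1.le hρε hκε
  have hG4 : G ≤ 4 * (trimmedMoment x p k + k * rankedFreq x ⌈(k : ℝ) - ε * k⌉₊ ^ p) := by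
    rcases le_total (trimmedScale x p k) (trimmedScale y p k) with hle | hle
    · have hGe : G = trimmedScale y p k := max_eq_right hle
      rw [hGe] at hG hyx ⊢
      exact trimmed_close_of_scale_le hp hρ hκ hk hle hG hJy hyx hε0 hε1 hρε hκε
    · have hGe : G = trimmedScale x p k := max_eq_left hle
      -- When `x` itself has the larger scale, `|a_k| ≤ |a_{⌈k-εk⌉}|` is enough.
      have : k * rankedFreq x k ^ p ≤ k * rankedFreq x ⌈(k : ℝ) - ε * k⌉₊ ^ p := by
        rcases Nat.eq_zero_or_pos k with hk0 | hk0
        · simp [hk0]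
        · have hkpos : (0 : ℝ) < k := by exact_mod_cast hk0
          gcongr
          · exact rankedFreq_nonneg x k
          · apply rankedFreq_antitone x _ _ (by omega)
            · rw [Nat.one_le_ceil_iff]; nlinarith
            · rw [Nat.ceil_le]; nlinarith
      have hs : trimmedScale x p k = trimmedMoment x p k + k * rankedFreq x k ^ p := rfl
      linarith
  have : ε / 16 * G ≤ ε * (trimmedMoment x p k + k * rankedFreq x ⌈(k : ℝ) - ε * k⌉₊ ^ p) := by
    nlinarith
  rw [abs_le]
  constructor <;> linarith

end Compare

/-! ### Uniform probability on finite types: union bound, Markov, conditioning, majority votes. -/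

section Probability

open scoped BigOperators

open Classical in
/-- The probability of an event under the uniform distribution on a finite type. -/
noncomputable def pr {Ω : Type} [Fintype Ω] (E : Ω → Prop) : ℝ := 𝔼 ω, if E ω then 1 else 0

variable {Ω Ω' : Type} [Fintype Ω] [Fintype Ω']

open Classical in
theorem pr_eq_card_div (E : Ω → Prop) : pr E = (#{ω | E ω} : ℝ) / Fintype.card Ω := by
  rw [pr, Fintype.expect_eq_sum_div_card, sum_boole]

theorem pr_le_one (E : Ω → Prop) : pr E ≤ 1 := by
  classical
  rw [pr_eq_card_div]
  apply div_le_one_of_le₀ _ (Nat.cast_nonneg _)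
  exact_mod_cast card_le_univ _

theorem pr_mono {E E' : Ω → Prop} (h : ∀ ω, E ω → E' ω) : pr E ≤ pr E' := by
  apply expect_le_expect
  intro ω _
  by_cases h1 : E ω
  · simp [h1, h ω h1]
  · rw [if_neg h1]; split_ifs <;> norm_num

theorem pr_or_le (E E' : Ω → Prop) : pr (fun ω => E ω ∨ E' ω) ≤ pr E + pr E' := by
  rw [pr, pr, pr, ← expect_add_distrib]
  apply expect_le_expect
  intro ω _
  by_cases h1 : E ω <;> by_cases h2 : E' ω <;> simp [h1, h2]

theorem pr_exists_le {ι : Type*} (A : Finset ι) (E : ι → Ω → Prop) :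
    pr (fun ω => ∃ i ∈ A, E i ω) ≤ ∑ i ∈ A, pr (E i) := by
  classical
  induction A using Finset.induction_on with
  | empty => simp [pr]
  | insert a A ha ih =>
    rw [sum_insert ha]
    refine (pr_mono fun ω h => ?_).trans ((pr_or_le (E a) _).trans (add_le_add le_rfl ih))
    simpa using h

theorem pr_not [Nonempty Ω] (E : Ω → Prop) : pr (fun ω => ¬ E ω) = 1 - pr E := by
  rw [eq_sub_iff_add_eq, pr, pr, ← expect_add_distrib]
  refine (expect_congr rfl fun ω _ => ?_).trans (Fintype.expect_one (ι := Ω))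
  by_cases h : E ω <;> simp [h]

theorem pr_lt_le_div {f : Ω → ℝ} (hf : ∀ ω, 0 ≤ f ω) {a : ℝ} (ha : 0 < a) :
    pr (fun ω => a < f ω) ≤ (𝔼 ω, f ω) / a := by
  rw [le_div_iff₀ ha, pr, expect_mul]
  apply expect_le_expect
  intro ω _
  split_ifs with h
  · linarith
  · simpa using hf ω

/-- Conditioning on the first component; it allows the sample to be fixed before the bucket and sign
functions are drawn. -/
theorem pr_prod_le [Nonempty Ω'] (E : Ω × Ω' → Prop) (B : Ω → Prop) {q : ℝ} (hq : 0 ≤ q)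
    (h : ∀ ω, ¬ B ω → pr (fun ω' => E (ω, ω')) ≤ q) : pr E ≤ pr B + q := by
  classical
  have hE : pr E = 𝔼 ω, pr (fun ω' => E (ω, ω')) := by
    rw [pr, ← univ_product_univ, expect_product]; rfl
  rcases isEmpty_or_nonempty Ω with hΩ | hΩ
  · simp [pr, hq]
  · rw [hE]
    calc _ ≤ 𝔼 ω, ((if B ω then 1 else 0) + q) := by
          apply expect_le_expect
          intro ω _
          by_cases hB : B ω
          · simp only [if_pos hB]; linarith [pr_le_one fun ω' => E (ω, ω')]
          · simpa [hB] using h ω hB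
      _ = _ := by
          rw [expect_add_distrib, Fintype.expect_const, pr]

theorem pr_equiv (e : Ω ≃ Ω') (E : Ω' → Prop) : pr (fun ω => E (e ω)) = pr E :=
  Fintype.expect_equiv e _ _ fun _ => rfl

theorem pr_fst [Nonempty Ω'] (E : Ω → Prop) : pr (fun ω : Ω × Ω' => E ω.1) = pr E := by
  rw [pr, ← univ_product_univ, expect_product]
  refine expect_congr rfl fun ω _ => ?_
  by_cases h : E ω <;> simp [h]

open Classical in
/-- If each of `R` independent trials fails with probability at most `1/16`, then at least half
of them fail with probability at most `2^{-R}`. -/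
theorem pr_majority_le [Nonempty Ω] (E : Ω → Prop) (h : pr E ≤ 1 / 16) (R : ℕ) :
    pr (fun ω : Fin R → Ω => R ≤ 2 * #{r | E (ω r)}) ≤ (1 / 2) ^ R := by
  -- A Chernoff bound with weight `4` for a failure and `1/4` for a success: the mean is at most
  -- `(1/16)(15/4) + 1/4 < 1/2`, and the product of the weights is at least `1` once half of the
  -- trials fail.
  have hmean : 𝔼 a, (if E a then (4 : ℝ) else 1 / 4) ≤ 1 / 2 := by
    have : ∀ a, (if E a then (4 : ℝ) else 1 / 4) = (if E a then 1 else 0) * (15 / 4) + 1 / 4 := by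
      intro a; split_ifs <;> norm_num
    simp only [this]
    rw [expect_add_distrib, Fintype.expect_const, ← expect_mul]
    change pr E * _ + _ ≤ _
    linarith
  have hmean0 : 0 ≤ 𝔼 a, (if E a then (4 : ℝ) else 1 / 4) :=
    expect_nonneg fun a _ => by split_ifs <;> norm_num
  refine le_trans ?_ (pow_le_pow_left₀ hmean0 hmean R)
  rw [expect_pow, Fintype.piFinset_univ]
  apply expect_le_expect
  intro ω _
  have hprod : ∏ r, (if E (ω r) then (4 : ℝ) else 1 / 4) =
      4 ^ #{r | E (ω r)} * (1 / 4) ^ #{r | ¬ E (ω r)} := by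
    rw [prod_ite, prod_const, prod_const]
  rw [hprod]
  have hcard : #{r | E (ω r)} + #{r | ¬ E (ω r)} = R := by
    simpa using card_filter_add_card_filter_not (s := (univ : Finset (Fin R))) (fun r => E (ω r))
  split_ifs with hc
  · rw [one_div, inv_pow, ← div_eq_mul_inv, one_le_div₀ (by positivity)]
    exact pow_le_pow_right₀ (by norm_num) (by omega)
  · positivity

end Probability

/-! ### Affine hash functions over a finite field: moments and bucket noise. -/

section PairwiseHash

open scoped BigOperators

variable {F : Type} [Field F]

/-- The hash value of `a` under the affine map with coefficients `g`. -/
def hashVal (g : F × F) (a : F) : F := g.1 * a + g.2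

/-- At two different points the values of an affine map determine it and can be prescribed. -/
def hashEquiv {a b : F} (h : a ≠ b) : F × F ≃ F × F where
  toFun g := (hashVal g a, hashVal g b)
  invFun u := ((u.1 - u.2) / (a - b), u.1 - (u.1 - u.2) / (a - b) * a)
  left_inv g := by
    have : a - b ≠ 0 := sub_ne_zero.2 h
    ext
    · simp only [hashVal]; field_simp; ring
    · simp only [hashVal]; field_simp; ring
  right_inv u := by
    have : a - b ≠ 0 := sub_ne_zero.2 h
    ext
    · simp only [hashVal]; ring
    · simp only [hashVal]; field_simp; ring

variable [Fintype F]

theorem expect_hashVal_mul {a b : F} (h : a ≠ b) (f f' : F → ℝ) :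
    𝔼 g, f (hashVal g a) * f' (hashVal g b) = (𝔼 z, f z) * 𝔼 z, f' z := by
  rw [Fintype.expect_mul_expect, ← expect_product' univ univ fun i j => f i * f' j,
    univ_product_univ]
  exact Fintype.expect_equiv (hashEquiv h) _ _ fun g => rfl

theorem expect_hashVal (a : F) (f : F → ℝ) : 𝔼 g, f (hashVal g a) = 𝔼 z, f z := by
  -- Any second point serves to apply the two-point formula.
  have h : a ≠ a + 1 := by simp
  simpa using expect_hashVal_mul h f fun _ => 1

/-- The cross terms vanish, since distinct codes have independent hash values and `f` has mean zero.
-/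
theorem expect_sum_hashVal_sq {I : Type*} (A : Finset I) {code : I → F}
    (hcode : Function.Injective code) (c : I → ℝ) {f : F → ℝ} (hf : 𝔼 z, f z = 0) :
    𝔼 g, (∑ i ∈ A, c i * f (hashVal g (code i))) ^ 2 = (∑ i ∈ A, c i ^ 2) * 𝔼 z, f z ^ 2 := by
  classical
  have h1 : ∀ g : F × F, (∑ i ∈ A, c i * f (hashVal g (code i))) ^ 2 = ∑ i ∈ A, ∑ j ∈ A,
      (c i * c j) * (f (hashVal g (code i)) * f (hashVal g (code j))) := by
    intro g
    rw [sq, sum_mul_sum]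
    exact sum_congr rfl fun i _ => sum_congr rfl fun j _ => by ring
  simp only [h1]
  rw [expect_sum_comm, sum_mul]
  refine sum_congr rfl fun i hi => ?_
  rw [expect_sum_comm, sum_eq_single i]
  · rw [← mul_expect]
    simp only [← sq]
    rw [expect_hashVal (code i) fun z => f z ^ 2]
  · intro j _ hj
    rw [← mul_expect, expect_hashVal_mul (hcode.ne hj.symm), hf]; simp
  · exact fun h => absurd hi h

-- Chebyshev's inequality; pairwise independence bounds the variance of the sampled count by its
-- mean.
open Classical in
theorem pr_sample_count_le {I : Type*} (A : Finset I) {code : I → F}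
    (hcode : Function.Injective code) (P : F → Prop) {t : ℝ} (ht : 0 < t) :
    pr (fun g : F × F => t < |(#{i ∈ A | P (hashVal g (code i))} : ℝ) - #A * pr P|) ≤
      #A * pr P / t ^ 2 := by
  set f : F → ℝ := fun z => (if P z then 1 else 0) - pr P with hfdef
  have hf : 𝔼 z, f z = 0 := by
    rw [expect_sub_distrib, Fintype.expect_const]; exact sub_self _
  have hf2 : 𝔼 z, f z ^ 2 ≤ pr P := by
    have : ∀ z, f z ^ 2 = (if P z then 1 else 0) * (1 - 2 * pr P) + pr P ^ 2 := by
      intro z; simp only [hfdef]; split_ifs <;> ring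
    simp only [this]
    rw [expect_add_distrib, Fintype.expect_const, ← expect_mul]
    change pr P * _ + _ ≤ _
    nlinarith [sq_nonneg (pr P)]
  have hsum := expect_sum_hashVal_sq A hcode (fun _ => 1) hf
  have hm := pr_lt_le_div (f := fun g : F × F => (∑ i ∈ A, 1 * f (hashVal g (code i))) ^ 2)
    (fun _ => sq_nonneg _) (pow_pos ht 2)
  rw [hsum] at hm
  refine (pr_mono fun g hg => ?_).trans (hm.trans ?_)
  · have : ∑ i ∈ A, 1 * f (hashVal g (code i)) =
        (#{i ∈ A | P (hashVal g (code i))} : ℝ) - #A * pr P := by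
      simp [hfdef, sum_sub_distrib]
    rw [this, ← sq_abs (_ - _)]
    exact pow_lt_pow_left₀ hg ht.le (by norm_num)
  · gcongr
    simp

open Classical in
theorem pr_sample_sum_le {I : Type*} (A : Finset I) (code : I → F) {c : I → ℝ}
    (hc : ∀ i, 0 ≤ c i) (P : F → Prop) {t : ℝ} (ht : 0 < t) :
    pr (fun g : F × F => t < ∑ i ∈ A with P (hashVal g (code i)), c i) ≤
      (∑ i ∈ A, c i) * pr P / t := by
  refine (pr_lt_le_div (fun g => sum_nonneg fun i _ => hc i) ht).trans (le_of_eq ?_)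
  congr 1
  simp only [sum_filter]
  rw [expect_sum_comm, sum_mul]
  refine sum_congr rfl fun i _ => ?_
  rw [expect_hashVal (code i) fun z => if P z then c i else 0, pr, mul_expect]
  exact expect_congr rfl fun z _ => by split_ifs <;> simp

theorem pr_collision_eq {b : ℕ} {bucket : F → Fin b} (hb : ∀ c, pr (fun z => bucket z = c) = 1 / b)
    {u v : F} (h : u ≠ v) :
    pr (fun g => bucket (hashVal g u) = bucket (hashVal g v)) = 1 / b := by
  classical
  have h1 : ∀ g : F × F, (if bucket (hashVal g u) = bucket (hashVal g v) then (1 : ℝ) else 0) =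
      ∑ c, (if bucket (hashVal g u) = c then 1 else 0) *
        (if bucket (hashVal g v) = c then 1 else 0) := by
    intro g; simp [eq_comm]
  have hbpos : (b : ℝ) ≠ 0 := by
    have := (bucket u).pos
    positivity
  rw [pr]
  trans 𝔼 g : F × F, ∑ c, (if bucket (hashVal g u) = c then (1 : ℝ) else 0) *
        (if bucket (hashVal g v) = c then 1 else 0)
  · exact expect_congr rfl fun g _ => by rw [← h1]; congr
  rw [expect_sum_comm]
  have h2 : ∀ c, 𝔼 g : F × F, (if bucket (hashVal g u) = c then (1 : ℝ) else 0) *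
        (if bucket (hashVal g v) = c then 1 else 0) = 1 / b * (1 / b) := by
    intro c
    rw [expect_hashVal_mul h (fun z => if bucket z = c then (1 : ℝ) else 0)
      (fun z => if bucket z = c then (1 : ℝ) else 0)]
    have := hb c
    rw [pr] at this
    congr 1 <;> (rw [← this]; exact expect_congr rfl fun _ _ => by congr)
  simp only [h2, sum_const, card_univ, Fintype.card_fin, nsmul_eq_mul]
  field_simp

open Classical in
/-- The noise that the coordinates in `S` other than `i` contribute to the bucket of `i`. -/
noncomputable def bucketNoise {n b : ℕ} (code : Fin n → F) (bucket : F → Fin b) (sgn : F → ℤ)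
    (S : Finset (Fin n)) (x : Fin n → ℤ) (i : Fin n) (h : (F × F) × (F × F)) : ℝ :=
  ∑ j ∈ S.erase i with bucket (hashVal h.1 (code j)) = bucket (hashVal h.1 (code i)),
    (x j : ℝ) * sgn (hashVal h.2 (code j))

/-- Coordinates of size at least `v` are harmful only if they share the bucket of `i`, which a union
bound controls. The remaining ones are controlled by the second moment: the signs remove the cross
terms, and each square survives with probability `1 / b`. -/
theorem pr_bucketNoise_le {n b : ℕ} {code : Fin n → F} (hcode : Function.Injective code)
    {bucket : F → Fin b} (hb : ∀ c, pr (fun z => bucket z = c) = 1 / b) {sgn : F → ℤ}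
    (hsq : ∀ z, sgn z ^ 2 = 1) (hsgn : 𝔼 z, (sgn z : ℝ) = 0) (S : Finset (Fin n))
    (x : Fin n → ℤ) (i : Fin n) (v : ℝ) {t : ℝ} (ht : 0 < t) :
    pr (fun h => t < |bucketNoise code bucket sgn S x i h|) ≤
      (#{j ∈ S | v ≤ |(x j : ℝ)|} : ℝ) / b + (∑ j ∈ S with |(x j : ℝ)| < v, (x j : ℝ) ^ 2) / (b * t ^ 2) := by
  classical
  have hbpos : (0 : ℝ) < b := by
    have := (bucket 0).pos
    positivity
  set col : F × F → Fin n → Prop := fun g j =>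
    bucket (hashVal g (code j)) = bucket (hashVal g (code i)) with hcol
  set Hv : Finset (Fin n) := {j ∈ S.erase i | v ≤ |(x j : ℝ)|} with hHv
  set Lt : Finset (Fin n) := {j ∈ S.erase i | |(x j : ℝ)| < v} with hLt
  have hpc : ∀ j ≠ i, pr (fun g => col g j) = 1 / b := fun j hj =>
    pr_collision_eq hb (hcode.ne hj)
  set lightNoise : (F × F) × (F × F) → ℝ := fun h =>
    ∑ j ∈ Lt with col h.1 j, (x j : ℝ) * sgn (hashVal h.2 (code j)) with hln
  have hsub : ∀ h, t < |bucketNoise code bucket sgn S x i h| →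
      (∃ j ∈ Hv, col h.1 j) ∨ t ^ 2 < lightNoise h ^ 2 := by
    intro h hh
    by_contra! hcon
    obtain ⟨h1, h2⟩ := hcon
    have heq : bucketNoise code bucket sgn S x i h = lightNoise h := by
      unfold bucketNoise
      rw [hln]
      refine (sum_congr ?_ fun _ _ => rfl)
      ext j
      simp only [mem_filter, hLt]
      constructor
      · rintro ⟨hj1, hj2⟩
        refine ⟨⟨hj1, ?_⟩, hj2⟩
        by_contra hv
        exact h1 j (by simp only [hHv, mem_filter]; exact ⟨hj1, not_lt.1 hv⟩) hj2
      · rintro ⟨⟨hj1, _⟩, hj2⟩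
        exact ⟨hj1, hj2⟩
    rw [heq] at hh
    have := pow_lt_pow_left₀ hh ht.le (n := 2) (by norm_num)
    rw [sq_abs] at this
    linarith
  refine (pr_mono hsub).trans ((pr_or_le _ _).trans (add_le_add ?_ ?_))
  · rw [pr_fst fun g => ∃ j ∈ Hv, col g j]
    refine (pr_exists_le Hv fun j g => col g j).trans ?_
    calc ∑ j ∈ Hv, pr (fun g => col g j) = ∑ j ∈ Hv, (1 / b : ℝ) := by
          refine sum_congr rfl fun j hj => hpc j ?_
          simp only [hHv, mem_filter, mem_erase] at hj
          exact hj.1.1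
      _ = #Hv / b := by simp [div_eq_mul_inv]
      _ ≤ _ := by
          gcongr
          exact filter_subset_filter _ (erase_subset _ _)
  · refine (pr_lt_le_div (fun h => sq_nonneg (lightNoise h)) (pow_pos ht 2)).trans ?_
    rw [← div_div]
    gcongr
    rw [← univ_product_univ, expect_product]
    have h1 : ∀ g : F × F, 𝔼 g', lightNoise (g, g') ^ 2 =
        ∑ j ∈ Lt, (if col g j then (x j : ℝ) ^ 2 else 0) := by
      intro g
      simp only [hln]
      rw [expect_sum_hashVal_sq _ hcode (fun j => (x j : ℝ)) hsgn, sum_filter]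
      have : ∀ z, (sgn z : ℝ) ^ 2 = 1 := fun z => by exact_mod_cast hsq z
      simp [this]
    simp only [h1]
    rw [expect_sum_comm, sum_div]
    calc _ = ∑ j ∈ Lt, (x j : ℝ) ^ 2 / b := by
          refine sum_congr rfl fun j hj => ?_
          simp only [hLt, mem_filter, mem_erase] at hj
          rw [div_eq_mul_one_div, ← hpc j hj.1.1, pr, mul_expect]
          exact expect_congr rfl fun g _ => by split_ifs <;> simp
      _ ≤ _ := by
          apply sum_le_sum_of_subset_of_nonneg
          · exact filter_subset_filter _ (erase_subset _ _)
          · intros; positivity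

end PairwiseHash

/-! ### The random sketching matrix and the good seeds. -/

section HashSystem

open scoped BigOperators

/-- Labels on a finite field which turn pairwise independent hash functions into nested samples of
the coordinates at rates `2^{-s}`, `s ≤ m`, into functions to `b` buckets, and into random signs. -/
structure HashSystem (n m b : ℕ) (F : Type) [Field F] [Fintype F] where
  code : Fin n → F
  code_injective : Function.Injective code
  sel : ℕ → F → Prop
  sel_zero : ∀ z, sel 0 z
  pr_sel : ∀ s ≤ m, pr (sel s) = 1 / 2 ^ s
  bucket : F → Fin b
  pr_bucket : ∀ c, pr (fun z => bucket z = c) = 1 / b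
  sgn : F → ℤ
  sgn_sq : ∀ z, sgn z ^ 2 = 1
  expect_sgn : 𝔼 z, (sgn z : ℝ) = 0

theorem pr_fin_lt {N M : ℕ} (h : M ≤ N) : pr (fun z : Fin N => (z : ℕ) < M) = M / N := by
  classical
  rw [pr_eq_card_div, Fintype.card_fin]
  congr 2
  refine Eq.trans ?_ (Fintype.card_fin M)
  rw [← card_univ, ← card_map (Fin.castLEEmb h)]
  congr 1
  ext z
  simp only [mem_filter, mem_univ, true_and, mem_map, Fin.castLEEmb_apply]
  constructor
  · exact fun h => ⟨⟨z, h⟩, rfl⟩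
  · rintro ⟨a, rfl⟩; exact a.2

theorem pr_eq_point {Ω : Type} [Fintype Ω] (c : Ω) :
    pr (fun z => z = c) = 1 / Fintype.card Ω := by
  classical
  rw [pr_eq_card_div]
  congr 1
  exact_mod_cast card_eq_one.2 ⟨c, by ext; simp⟩

/-- In a field with `2^q` elements all required probabilities are exact dyadic fractions, and a hash
function costs exactly `2q` bits. The three labelings of the field may be unrelated, because
samples, buckets and signs use separate hash functions. -/
theorem exists_hashSystem {n m β q : ℕ} (hn : n ≤ 2 ^ q) (hm : m ≤ q) (hβ : β ≤ q) (hq : 1 ≤ q) :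
    ∃ (F : Type) (_ : Field F) (_ : Fintype F), Fintype.card F = 2 ^ q ∧
      Nonempty (HashSystem n m (2 ^ β) F) := by
  classical
  let _ : Fintype (GaloisField 2 q) := Fintype.ofFinite _
  have hcard : Fintype.card (GaloisField 2 q) = 2 ^ q := by
    rw [← Nat.card_eq_fintype_card]; exact GaloisField.card 2 q (by omega)
  refine ⟨GaloisField 2 q, inferInstance, inferInstance, hcard, ?_⟩
  have e : GaloisField 2 q ≃ Fin (2 ^ q) := Fintype.equivFinOfCardEq hcard
  have eb : GaloisField 2 q ≃ Fin (2 ^ β) × Fin (2 ^ (q - β)) := Fintype.equivOfCardEq (by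
    rw [hcard, Fintype.card_prod, Fintype.card_fin, Fintype.card_fin, ← pow_add]; congr 1; omega)
  have es : GaloisField 2 q ≃ Bool × Fin (2 ^ (q - 1)) := Fintype.equivOfCardEq (by
    rw [hcard, Fintype.card_prod, Fintype.card_bool, Fintype.card_fin, ← pow_succ']
    congr 1; omega)
  exact ⟨{
    code := fun i => e.symm (Fin.castLE hn i)
    code_injective := fun i j h => by
      have := e.symm.injective h
      simpa [Fin.ext_iff] using this
    sel := fun s z => (e z : ℕ) < 2 ^ (q - s)
    sel_zero := fun z => (e z).2
    pr_sel := fun s hs => by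
      rw [pr_equiv e fun z => (z : ℕ) < 2 ^ (q - s),
        pr_fin_lt (Nat.pow_le_pow_right (by norm_num) (by omega))]
      push_cast
      rw [div_eq_div_iff (by positivity) (by positivity), one_mul, ← pow_add]
      congr 1; omega
    bucket := fun z => (eb z).1
    pr_bucket := fun c => by
      have : Nonempty (Fin (2 ^ (q - β))) := ⟨⟨0, by positivity⟩⟩
      rw [pr_equiv eb fun z => z.1 = c, pr_fst fun z => z = c, pr_eq_point, Fintype.card_fin]
    sgn := fun z => if (es z).1 then 1 else -1
    sgn_sq := fun z => by split_ifs <;> norm_num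
    expect_sgn := by
      have : Nonempty (Fin (2 ^ (q - 1))) := ⟨⟨0, by positivity⟩⟩
      rw [Fintype.expect_equiv es _
        (fun z : Bool × Fin (2 ^ (q - 1)) => (((if z.1 then 1 else -1 : ℤ)) : ℝ)) fun z => rfl,
        ← univ_product_univ, expect_product]
      refine (expect_congr rfl (g := fun b : Bool => (((if b then 1 else -1 : ℤ)) : ℝ))
        fun z _ => Fintype.expect_const (ι := Fin (2 ^ (q - 1))) _).trans ?_
      rw [Fintype.expect_eq_sum_div_card]
      simp }⟩

variable {n m b : ℕ} {F : Type} [Field F] [Fintype F]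

/-- The seed of a sketch with `R` repetitions: one hash function for the samples, and for each
repetition one for the buckets and one for the signs. -/
abbrev HashSeed (F : Type) (R : ℕ) : Type := (F × F) × (Fin R → (F × F) × (F × F))

namespace HashSystem

variable (H : HashSystem n m b F) {R : ℕ}

open Classical in
/-- The coordinates that are sampled at level `s`. -/
noncomputable def sample (s : ℕ) (g : F × F) : Finset (Fin n) :=
  {i | H.sel s (hashVal g (H.code i))}

open Classical in
/-- The sketching matrix: for each level and repetition, a row of signs for each bucket. -/
noncomputable def matrix (ω : HashSeed F R) :
    Matrix (Fin (m + 1) × Fin R × Fin b) (Fin n) ℤ := fun t j =>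
  if H.sel t.1 (hashVal ω.1 (H.code j)) ∧ H.bucket (hashVal (ω.2 t.2.1).1 (H.code j)) = t.2.2
  then H.sgn (hashVal (ω.2 t.2.1).2 (H.code j)) else 0

theorem abs_sgn (z : F) : |H.sgn z| = 1 := by
  rcases sq_eq_one_iff.1 (H.sgn_sq z) with h | h <;> simp [h]

theorem abs_matrix_le (ω : HashSeed F R) (t : Fin (m + 1) × Fin R × Fin b) (j : Fin n) :
    |H.matrix ω t j| ≤ 1 := by
  unfold matrix
  split_ifs
  · exact (H.abs_sgn _).le
  · simp

/-- The noise of the bucket of `i` in repetition `r` at level `s`. -/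
noncomputable def noise (s : ℕ) (ω : HashSeed F R) (x : Fin n → ℤ) (i : Fin n) (r : Fin R) : ℝ :=
  bucketNoise H.code H.bucket H.sgn (H.sample s ω.1) x i (ω.2 r)

theorem counter_eq (ω : HashSeed F R) (x : Fin n → ℤ) {s : ℕ} (hs : s < m + 1) {i : Fin n}
    (hi : i ∈ H.sample s ω.1) (r : Fin R) :
    (((H.matrix ω).mulVec x
      (⟨s, hs⟩, r, H.bucket (hashVal (ω.2 r).1 (H.code i))) : ℤ) : ℝ) =
      x i * H.sgn (hashVal (ω.2 r).2 (H.code i)) + H.noise s ω x i r := by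
  classical
  simp only [Matrix.mulVec, dotProduct, matrix, noise, bucketNoise]
  push_cast
  have h1 : ∀ j, ((if H.sel s (hashVal ω.1 (H.code j)) ∧
      H.bucket (hashVal (ω.2 r).1 (H.code j)) = H.bucket (hashVal (ω.2 r).1 (H.code i))
      then (H.sgn (hashVal (ω.2 r).2 (H.code j)) : ℝ) else 0) * (x j : ℝ)) =
      if H.sel s (hashVal ω.1 (H.code j)) then
      (if H.bucket (hashVal (ω.2 r).1 (H.code j)) = H.bucket (hashVal (ω.2 r).1 (H.code i))
        then (x j : ℝ) * H.sgn (hashVal (ω.2 r).2 (H.code j)) else 0) else 0 := by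
    intro j
    by_cases h1 : H.sel s (hashVal ω.1 (H.code j)) <;>
    by_cases h2 : H.bucket (hashVal (ω.2 r).1 (H.code j)) =
      H.bucket (hashVal (ω.2 r).1 (H.code i)) <;> simp [h1, h2, mul_comm]
  simp only [h1]
  rw [← sum_filter]
  change ∑ j ∈ H.sample s ω.1, _ = _
  rw [← add_sum_erase _ _ hi, if_pos rfl, sum_filter]

/-- Two strict majorities of repetitions intersect. In a common quiet repetition the equal counters
are `±x_i` and `±y_i` with the same sign, each up to noise `t`. -/
theorem abs_sub_le_of_counter_eq {ω : HashSeed F R} {x y : Fin n → ℤ}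
    (hxy : (H.matrix ω).mulVec x = (H.matrix ω).mulVec y) {s : ℕ} (hs : s < m + 1) {i : Fin n}
    (hi : i ∈ H.sample s ω.1) {t : ℝ}
    (hx : 2 * #{r | t < |H.noise s ω x i r|} < R) (hy : 2 * #{r | t < |H.noise s ω y i r|} < R) :
    |(x i : ℝ) - y i| ≤ 2 * t := by
  classical
  obtain ⟨r, hr⟩ : ∃ r, r ∉ ({r | t < |H.noise s ω x i r|} : Finset (Fin R)) ∪
      ({r | t < |H.noise s ω y i r|} : Finset (Fin R)) := by
    by_contra! hall
    have h1 := card_le_card (fun r _ => hall r :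
      (univ : Finset (Fin R)) ⊆ _)
    have h2 := h1.trans (card_union_le _ _)
    rw [card_univ, Fintype.card_fin] at h2
    omega
  simp only [mem_union, mem_filter, mem_univ, true_and, not_or, not_lt] at hr
  have ex := H.counter_eq ω x hs hi r
  have ey := H.counter_eq ω y hs hi r
  rw [hxy, ey] at ex
  set σ : ℤ := H.sgn (hashVal (ω.2 r).2 (H.code i))
  have hσ : |(σ : ℝ)| = 1 := by exact_mod_cast H.abs_sgn _
  have : ((x i : ℝ) - y i) * σ = H.noise s ω y i r - H.noise s ω x i r := by linarith
  calc |(x i : ℝ) - y i| = |((x i : ℝ) - y i) * σ| := by rw [abs_mul, hσ, mul_one]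
    _ ≤ |H.noise s ω y i r| + |H.noise s ω x i r| := by rw [this]; exact abs_sub _ _
    _ ≤ 2 * t := by linarith

/-- The seed behaves well on `x` at threshold `v` and level `s`: if few coordinates reach `v`, then
the sample estimates their number up to `Δ`, and if moreover the other coordinates have small
energy, then most repetitions have small noise at every coordinate. -/
def GoodAt (M D Δ η : ℝ) (x : Fin n → ℤ) (v : ℝ) (s : ℕ) (ω : HashSeed F R) : Prop :=
  freqCount x v ≤ M * 2 ^ s →
    |(#{i ∈ H.sample s ω.1 | v ≤ |(x i : ℝ)|} : ℝ) - freqCount x v / 2 ^ s| ≤ Δ ∧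
    (∑ i with |(x i : ℝ)| < v, (x i : ℝ) ^ 2 ≤ D * v ^ 2 * 2 ^ s →
      ∀ i, 2 * #{r | η * v < |H.noise s ω x i r|} < R)

/-- The three terms are Chebyshev for the sampled count, Markov for the sampled energy below `v`,
and, once the sample is fixed and both are fine, a union bound over the coordinates of the majority
estimate. The hypothesis `hb` makes a single repetition fail with probability at most `1/16`. -/
theorem pr_not_goodAt_le {M D Δ η lam : ℝ} (hM : 0 < M) (hD : 0 < D) (hΔ : 0 < Δ) (hη : 0 < η)
    (hlam : 0 < lam) (hb : (M + Δ) / b + lam * D / (b * η ^ 2) ≤ 1 / 16) (x : Fin n → ℤ) {v : ℝ}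
    (hv : 0 < v) {s : ℕ} (hs : s ≤ m) :
    pr (fun ω : HashSeed F R => ¬ H.GoodAt M D Δ η x v s ω) ≤
      M / Δ ^ 2 + 1 / lam + n * (1 / 2) ^ R := by
  classical
  by_cases hN : (freqCount x v : ℝ) ≤ M * 2 ^ s
  swap
  · have : pr (fun ω : HashSeed F R => ¬ H.GoodAt M D Δ η x v s ω) = 0 := by
      simp [GoodAt, hN, pr]
    rw [this]; positivity
  set Q : Prop := ∑ i with |(x i : ℝ)| < v, (x i : ℝ) ^ 2 ≤ D * v ^ 2 * 2 ^ s with hQ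
  set B1 : F × F → Prop := fun g =>
    Δ < |(#{i ∈ H.sample s g | v ≤ |(x i : ℝ)|} : ℝ) - freqCount x v / 2 ^ s| with hB1
  set B2 : F × F → Prop := fun g => Q ∧
    lam * D * v ^ 2 < ∑ i ∈ H.sample s g with |(x i : ℝ)| < v, (x i : ℝ) ^ 2 with hB2
  have h2s : (0 : ℝ) < 2 ^ s := by positivity
  have hswap : ∀ (g : F × F) (P : Fin n → Prop) [DecidablePred P],
      {i ∈ H.sample s g | P i} =
        {i ∈ ({i | P i} : Finset (Fin n)) | H.sel s (hashVal g (H.code i))} := by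
    intro g P _
    ext i; simp only [sample, mem_filter, mem_univ, true_and, and_comm]
  have p1 : pr B1 ≤ M / Δ ^ 2 := by
    have h := pr_sample_count_le ({i | v ≤ |(x i : ℝ)|} : Finset (Fin n)) H.code_injective
      (H.sel s) hΔ
    rw [H.pr_sel s hs] at h
    refine (pr_mono fun g hg => ?_).trans (h.trans ?_)
    · rw [hB1] at hg
      simp only [hswap, freqCount] at hg
      rwa [mul_one_div]
    · gcongr
      rw [mul_one_div, div_le_iff₀ h2s]
      exact hN
  have p2 : pr B2 ≤ 1 / lam := by
    by_cases hq : Q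
    swap
    · have : pr B2 = 0 := by simp [hB2, hq, pr]
      rw [this]; positivity
    have h := pr_sample_sum_le ({i | |(x i : ℝ)| < v} : Finset (Fin n)) H.code
      (c := fun i => (x i : ℝ) ^ 2) (fun i => sq_nonneg _) (H.sel s)
      (t := lam * D * v ^ 2) (by positivity)
    rw [H.pr_sel s hs] at h
    refine (pr_mono fun g hg => ?_).trans (h.trans ?_)
    · have := hg.2
      rw [hswap] at this
      exact this
    · rw [div_le_div_iff₀ (by positivity) hlam, mul_one_div, div_mul_eq_mul_div, div_le_iff₀ h2s]
      rw [hQ] at hq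
      nlinarith
  have p12 : pr (fun g => B1 g ∨ B2 g) ≤ M / Δ ^ 2 + 1 / lam :=
    (pr_or_le B1 B2).trans (add_le_add p1 p2)
  refine (pr_prod_le _ (fun g => B1 g ∨ B2 g) (q := n * (1 / 2) ^ R) (by positivity) ?_).trans
    (add_le_add p12 le_rfl)
  intro g hg
  simp only [not_or] at hg
  obtain ⟨g1, g2⟩ := hg
  simp only [hB1, not_lt] at g1
  by_cases hq : Q
  swap
  · have : pr (fun h : Fin R → (F × F) × (F × F) => ¬ H.GoodAt M D Δ η x v s (g, h)) = 0 := by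
      have : ∀ h : Fin R → (F × F) × (F × F), H.GoodAt M D Δ η x v s (g, h) :=
        fun h _ => ⟨g1, fun hc => absurd hc hq⟩
      simp [this, pr]
    rw [this]; positivity
  have g3 : ∑ i ∈ H.sample s g with |(x i : ℝ)| < v, (x i : ℝ) ^ 2 ≤ lam * D * v ^ 2 := by
    by_contra hc
    exact g2 ⟨hq, not_le.1 hc⟩
  have hbad : ∀ i, pr (fun h => η * v <
      |bucketNoise H.code H.bucket H.sgn (H.sample s g) x i h|) ≤ 1 / 16 := by
    intro i
    have hbpos : (0 : ℝ) < b := by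
      have := (H.bucket 0).pos
      positivity
    refine (pr_bucketNoise_le H.code_injective H.pr_bucket H.sgn_sq H.expect_sgn _ x i v
      (mul_pos hη hv)).trans (le_trans (add_le_add ?_ ?_) hb)
    · gcongr
      have h1 := (abs_le.1 g1).2
      have h2 : (freqCount x v : ℝ) / 2 ^ s ≤ M := by rwa [div_le_iff₀ h2s]
      linarith
    · rw [div_le_div_iff₀ (by positivity) (by positivity)]
      calc _ ≤ lam * D * v ^ 2 * (b * η ^ 2) := by gcongr
        _ = _ := by ring
  calc pr (fun h : Fin R → (F × F) × (F × F) => ¬ H.GoodAt M D Δ η x v s (g, h))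
      ≤ pr (fun h : Fin R → (F × F) × (F × F) => ∃ i ∈ (univ : Finset (Fin n)),
          R ≤ 2 * #{r | η * v < |bucketNoise H.code H.bucket H.sgn (H.sample s g) x i (h r)|}) := by
        apply pr_mono
        intro h hh
        by_contra! hc
        exact hh fun _ => ⟨g1, fun _ i => hc i (mem_univ i)⟩
    _ ≤ ∑ i : Fin n, (1 / 2) ^ R := by
        refine (pr_exists_le _ _).trans (sum_le_sum fun i _ => ?_)
        refine le_trans (pr_mono fun h hh => ?_) (pr_majority_le _ (hbad i) R)
        convert hh
    _ = _ := by simp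

/-- A sampled coordinate with `|x_i| ≥ v` has `|y_i| ≥ (1 - 2η) v ≥ v / ρ`, so the sampled counts
are ordered. Each sampled count costs an error `Δ 2^s` when scaled up; at level `0` everything is
sampled and there is no error. -/
theorem freqCount_le_of_goodAt {M D Δ η ρ v : ℝ} {x y : Fin n → ℤ} {ω : HashSeed F R} {s : ℕ}
    (hxy : (H.matrix ω).mulVec x = (H.matrix ω).mulVec y) (hs : s < m + 1) (hv : 0 < v)
    (hηρ : 1 / ρ ≤ 1 - 2 * η)
    (hx : H.GoodAt M D Δ η x v s ω) (hy : H.GoodAt M D Δ η y v s ω)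
    (hy' : H.GoodAt M D Δ η y (v / ρ) s ω)
    (hNx : freqCount x v ≤ M * 2 ^ s) (hNy : freqCount y v ≤ M * 2 ^ s)
    (hNy' : freqCount y (v / ρ) ≤ M * 2 ^ s)
    (hLx : ∑ i with |(x i : ℝ)| < v, (x i : ℝ) ^ 2 ≤ D * v ^ 2 * 2 ^ s)
    (hLy : ∑ i with |(y i : ℝ)| < v, (y i : ℝ) ^ 2 ≤ D * v ^ 2 * 2 ^ s) :
    (freqCount x v : ℝ) ≤ freqCount y (v / ρ) + 2 * Δ * 2 ^ s ∧
      (s = 0 → freqCount x v ≤ freqCount y (v / ρ)) := by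
  classical
  have hclose : ∀ i ∈ H.sample s ω.1, v ≤ |(x i : ℝ)| → v / ρ ≤ |(y i : ℝ)| := by
    intro i hi hvi
    have h1 := H.abs_sub_le_of_counter_eq hxy hs hi ((hx hNx).2 hLx i) ((hy hNy).2 hLy i)
    have h2 := abs_sub_abs_le_abs_sub (x i : ℝ) (y i)
    have h3 : v / ρ ≤ v * (1 - 2 * η) := by
      rw [div_eq_mul_one_div]; gcongr
    linarith
  have hcard : #{i ∈ H.sample s ω.1 | v ≤ |(x i : ℝ)|} ≤
      #{i ∈ H.sample s ω.1 | v / ρ ≤ |(y i : ℝ)|} := by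
    apply card_le_card
    intro i hi
    rw [mem_filter] at hi ⊢
    exact ⟨hi.1, hclose i hi.1 hi.2⟩
  constructor
  · have h1 := (abs_le.1 (hx hNx).1).1
    have h2 := (abs_le.1 (hy' hNy').1).2
    have h3 : (#{i ∈ H.sample s ω.1 | v ≤ |(x i : ℝ)|} : ℝ) ≤
      #{i ∈ H.sample s ω.1 | v / ρ ≤ |(y i : ℝ)|} := by exact_mod_cast hcard
    have h2s : (0 : ℝ) < 2 ^ s := by positivity
    have h4 : (freqCount x v : ℝ) / 2 ^ s ≤ (freqCount y (v / ρ) + 2 * Δ * 2 ^ s) / 2 ^ s := by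
      rw [add_div, mul_div_cancel_right₀ _ h2s.ne']
      linarith
    exact (div_le_div_iff_of_pos_right h2s).1 h4
  · rintro rfl
    have : H.sample 0 ω.1 = univ := by
      ext i; simp [sample, H.sel_zero]
    rw [this] at hcard
    exact hcard

theorem countsLe_of_goodAt {k J : ℕ} {p ρ κ G P η : ℝ} {x y : Fin n → ℤ} {ω : HashSeed F R}
    (hp : 2 < p) (hρ : 1 < ρ) (hρ2 : ρ ^ p ≤ 2) (hηρ : 1 / ρ ≤ 1 - 2 * η) (hκ : 0 < κ)
    (hP : 1 ≤ P) (hk : 2 * k ≤ n) (hG : 0 < G) (hGm : G ≤ 2 ^ m)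
    (hGx : trimmedScale x p k ≤ G) (hGy : trimmedScale y p k ≤ G)
    (hxy : (H.matrix ω).mulVec x = (H.matrix ω).mulVec y)
    (hx : ∀ j ≤ J, ∀ s ≤ m, H.GoodAt (3 * P) (2 * P * (n : ℝ) ^ (1 - 2 / p)) (κ * P / 4) η x
      (ρ ^ j / ρ) s ω)
    (hy : ∀ j ≤ J, ∀ s ≤ m, H.GoodAt (3 * P) (2 * P * (n : ℝ) ^ (1 - 2 / p)) (κ * P / 4) η y
      (ρ ^ j / ρ) s ω) :
    CountsLe k J p ρ κ G x y := by
  intro j hj hkG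
  have hρ0 : 0 < ρ := by linarith
  have hp0 : 0 < p := by linarith
  set v := ρ ^ j with hvdef
  have hv1 : 1 ≤ v := one_le_pow₀ hρ.le
  have hv : 0 < v := by positivity
  have hvp : 0 < v ^ p := by positivity
  have hvp1 : 1 ≤ v ^ p := Real.one_le_rpow hv1 hp0.le
  -- The good events are indexed by `ρ^j / ρ` with `j ≤ J`, so that both `v` and `v / ρ` are among
  -- their thresholds.
  have hvj : v = ρ ^ (j + 1) / ρ := by rw [pow_succ]; field_simp; rfl
  have hex : ∃ s : ℕ, G ≤ 2 ^ s * (P * v ^ p) := by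
    refine ⟨m, hGm.trans (le_mul_of_one_le_right (by positivity) ?_)⟩
    nlinarith
  classical
  -- The bound `G ≤ 2^s P v^p` keeps the sample small. Minimality gives `2^s P v^p < 2G` when `s >
  -- 0`, which turns the error `2 (κ P / 4) 2^s` into less than `κ G / v^p`.
  obtain ⟨s, hs, hsmin⟩ : ∃ s : ℕ, G ≤ 2 ^ s * (P * v ^ p) ∧
      ∀ t < s, 2 ^ t * (P * v ^ p) < G :=
    ⟨Nat.find hex, Nat.find_spec hex, fun t ht => not_le.1 (Nat.find_min hex ht)⟩
  have hsm : s ≤ m := by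
    by_contra hc
    have h1 := hsmin m (not_le.1 hc)
    have : (1 : ℝ) ≤ P * v ^ p := by nlinarith
    have h2 : (2 : ℝ) ^ m ≤ 2 ^ m * (P * v ^ p) := le_mul_of_one_le_right (by positivity) this
    linarith
  have hN : ∀ z : Fin n → ℤ, trimmedScale z p k ≤ G →
      (freqCount z (v / ρ) : ℝ) ≤ 3 * P * 2 ^ s := by
    intro z hz
    have h1 := freqCount_le_scale z hp0.le hk (v := v / ρ) (by positivity)
    have h2 : (k : ℝ) ≤ P * 2 ^ s := by
      have : k * v ^ p ≤ P * 2 ^ s * v ^ p := by nlinarith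
      exact le_of_mul_le_mul_right this hvp
    have h3 : trimmedScale z p k / (v / ρ) ^ p ≤ 2 * (P * 2 ^ s) := by
      rw [Real.div_rpow hv.le hρ0.le, div_div_eq_mul_div, div_le_iff₀ hvp]
      have hz0 : 0 ≤ trimmedScale z p k :=
        (trimmedMoment_nonneg z p k).trans (trimmedMoment_le_scale z p k)
      calc _ ≤ G * 2 := by gcongr
        _ ≤ _ := by linarith
    linarith
  have hN' : ∀ z : Fin n → ℤ, trimmedScale z p k ≤ G →
      (freqCount z v : ℝ) ≤ 3 * P * 2 ^ s := by
    intro z hz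
    refine le_trans ?_ (hN z hz)
    exact_mod_cast freqCount_anti z (div_le_self hv.le hρ.le)
  have hL : ∀ z : Fin n → ℤ, trimmedScale z p k ≤ G →
      ∑ i with |(z i : ℝ)| < v, (z i : ℝ) ^ 2 ≤
        2 * P * (n : ℝ) ^ (1 - 2 / p) * v ^ 2 * 2 ^ s := by
    intro z hz
    refine (sum_light_sq_le z hp hk hv hz hkG).trans ?_
    have h1 : (2 * G) ^ (2 / p) ≤ 2 * P * 2 ^ s * v ^ 2 := by
      have h2s : (1 : ℝ) ≤ 2 ^ s := one_le_pow₀ (by norm_num)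
      -- As the base is at least `1`, its exponent `2 / p < 1` can be raised to `1`.
      have h1P : 1 ≤ 2 * P * 2 ^ s := by nlinarith
      calc (2 * G) ^ (2 / p) ≤ ((2 * P * 2 ^ s) * v ^ p) ^ (2 / p) := by
            apply Real.rpow_le_rpow (by positivity) _ (by positivity)
            linarith
        _ = (2 * P * 2 ^ s) ^ (2 / p) * v ^ 2 := by
            rw [Real.mul_rpow (by positivity) hvp.le, ← Real.rpow_mul hv.le,
              mul_div_cancel₀ _ hp0.ne']
            norm_num
        _ ≤ _ := by
            gcongr
            calc (2 * P * 2 ^ s) ^ (2 / p) ≤ (2 * P * 2 ^ s) ^ (1 : ℝ) := by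
                  apply Real.rpow_le_rpow_of_exponent_le h1P
                  rw [div_le_one hp0]; exact hp.le
              _ = _ := Real.rpow_one _
    calc _ ≤ (n : ℝ) ^ (1 - 2 / p) * (2 * P * 2 ^ s * v ^ 2) := by gcongr
      _ = _ := by ring
  have gx := hx (j + 1) hj s hsm
  have gy := hy (j + 1) hj s hsm
  rw [← hvj] at gx gy
  have key := H.freqCount_le_of_goodAt hxy (Nat.lt_succ_of_le hsm) hv hηρ gx gy
    (hy j hj.le s hsm) (hN' x hGx) (hN' y hGy) (hN y hGy) (hL x hGx) (hL y hGy)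
  have hpos : 0 ≤ κ * G / v ^ p := by positivity
  rcases Nat.eq_zero_or_pos s with h0 | h0
  · have : (freqCount x v : ℝ) ≤ freqCount y (v / ρ) := by exact_mod_cast key.2 h0
    linarith
  · refine key.1.trans (add_le_add le_rfl ?_)
    rw [le_div_iff₀ hvp]
    have h1 := hsmin (s - 1) (by omega)
    have h2 : (2 : ℝ) ^ s = 2 * 2 ^ (s - 1) := by
      rw [← pow_succ']; congr 1; omega
    rw [h2]
    nlinarith

end HashSystem

end HashSystem

/-! ### The sketch and its decoder. -/

section Construction

variable {n : ℕ}

/-- A finite set of seeds of size a power of two, a family of matrices with entries in `{-1, 0, 1}`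
and a decoder form a linear sketch. -/
theorem exists_linearSketch {Ω T : Type} [Fintype Ω] [Fintype T] {d w : ℕ}
    (hd : Fintype.card Ω = 2 ^ d) (mat : Ω → Matrix T (Fin n) ℤ) (hmat : ∀ ω t j, |mat ω t j| ≤ 1)
    (dec : Ω → (T → ℤ) → ℝ) {M : ℝ} (hM : 2 * (n * M) < 2 ^ w) :
    ∃ S : LinearSketch n, S.space = d + Fintype.card T * w ∧ S.NoOverflow M ∧
      ∀ x v err, S.probWithin x v err = pr fun ω => |dec ω ((mat ω).mulVec x) - v| ≤ err := by
  classical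
  have e : (Fin d → Bool) ≃ Ω := Fintype.equivOfCardEq (by simp [hd])
  let f := Fintype.equivFin T
  let S : LinearSketch n :=
    { seedBits := d
      rows := Fintype.card T
      wordBits := w
      matrix := fun s r j => mat (e s) (f.symm r) j
      decode := fun s y => dec (e s) fun t => y (f t) }
  refine ⟨S, rfl, ?_, ?_⟩
  · intro s x hx r
    have h1 : |((S.matrix s).mulVec x r : ℝ)| ≤ n * M := by
      simp only [Matrix.mulVec, dotProduct]
      push_cast
      refine (abs_sum_le_sum_abs _ _).trans ?_
      calc ∑ j, |(S.matrix s r j : ℝ) * x j| ≤ ∑ j : Fin n, M := by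
            apply sum_le_sum
            intro j _
            rw [abs_mul]
            have h2 : |(S.matrix s r j : ℝ)| ≤ 1 := by exact_mod_cast hmat (e s) (f.symm r) j
            have h3 := hx j
            have h4 := abs_nonneg (x j : ℝ)
            nlinarith
        _ = n * M := by simp
    have h2 := abs_le.1 h1
    change -(2 : ℤ) ^ w ≤ _ ∧ _ < (2 : ℤ) ^ w
    constructor
    · have : (-(2 : ℝ) ^ w) ≤ 2 * (S.matrix s).mulVec x r := by linarith [h2.1]
      exact_mod_cast this
    · have : 2 * ((S.matrix s).mulVec x r : ℝ) < 2 ^ w := by linarith [h2.2]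
      exact_mod_cast this
  · intro x v err
    rw [← pr_equiv e, pr_eq_card_div, LinearSketch.probWithin]
    have hout : ∀ s, S.output s x = dec (e s) ((mat (e s)).mulVec x) := by
      intro s
      simp only [LinearSketch.output, S]
      congr 1
      funext t
      simp [Matrix.mulVec, dotProduct]
    have hc : (Fintype.card (Fin d → Bool) : ℝ) = 2 ^ S.seedBits := by simp [S]
    rw [hc]
    simp only [hout]
    rfl

theorem HashSystem.exists_sketch {m b q k J R w : ℕ} {F : Type} [Field F] [Fintype F]
    (H : HashSystem n m b F) (hF : Fintype.card F = 2 ^ q) {p ρ κ η P lam δ ε Mx : ℝ}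
    (hp : 2 < p) (hρ : 1 < ρ) (hη : 0 < η) (hηρ : 1 / ρ ≤ 1 - 2 * η) (hκ : 0 < κ) (hP : 1 ≤ P)
    (hlam : 0 < lam) (hn : 1 ≤ n) (hk : 2 * k ≤ n) (hMx : 0 ≤ Mx) (hJ : Mx < ρ ^ J)
    (hm : n * Mx ^ p ≤ 2 ^ m) (hw : 2 * (n * Mx) < 2 ^ w)
    (hε0 : 0 < ε) (hε1 : ε < 1) (hρε : (ρ ^ p) ^ 2 ≤ 1 + ε / 32) (hκε : J * κ ≤ ε / 64)
    (hb : (3 * P + κ * P / 4) / b + lam * (2 * P * (n : ℝ) ^ (1 - 2 / p)) / (b * η ^ 2) ≤ 1 / 16)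
    (hδ : (J + 1) * (m + 1) *
      (3 * P / (κ * P / 4) ^ 2 + 1 / lam + n * (1 / 2) ^ R) ≤ δ) :
    ∃ S : LinearSketch n, S.space = 2 * q + 4 * q * R + (m + 1) * R * b * w ∧ S.NoOverflow Mx ∧
      ∀ x : Fin n → ℤ, (∀ i, |(x i : ℝ)| ≤ Mx) →
        1 - δ ≤ S.probWithin x (trimmedMoment x p k)
          (ε * (trimmedMoment x p k + k * rankedFreq x ⌈(k : ℝ) - ε * k⌉₊ ^ p)) := by
  classical
  set Good : HashSeed F R → (Fin n → ℤ) → Prop := fun ω x => ∀ j ≤ J, ∀ s ≤ m,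
    H.GoodAt (3 * P) (2 * P * (n : ℝ) ^ (1 - 2 / p)) (κ * P / 4) η x (ρ ^ j / ρ) s ω with hGood
  -- The decoder picks any such vector; its default value `0` is never used when the seed is good
  -- for the input, as the input is then itself a candidate.
  set Ex : HashSeed F R → (Fin (m + 1) × Fin R × Fin b → ℤ) → Prop := fun ω y =>
    ∃ x, (∀ i, |(x i : ℝ)| ≤ Mx) ∧ Good ω x ∧ (H.matrix ω).mulVec x = y with hEx
  have hcard : Fintype.card (HashSeed F R) = 2 ^ (2 * q + 4 * q * R) := by
    simp only [Fintype.card_prod, Fintype.card_fun, hF, Fintype.card_fin]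
    ring
  obtain ⟨S, hS1, hS2, hS3⟩ := exists_linearSketch hcard H.matrix H.abs_matrix_le
    (fun ω y => if h : Ex ω y then trimmedMoment h.choose p k else 0) hw
  refine ⟨S, ?_, hS2, ?_⟩
  · rw [hS1]; simp [mul_assoc]
  intro x hx
  rw [hS3]
  have hρ0 : 0 < ρ := by linarith
  have hu : 1 ≤ ρ ^ p := Real.one_le_rpow hρ.le (by linarith)
  have hρ2 : ρ ^ p ≤ 2 := by nlinarith
  have hn0 : (0 : ℝ) < n := by exact_mod_cast hn
  have hne : Nonempty (HashSeed F R) := ⟨((0, 0), fun _ => ((0, 0), (0, 0)))⟩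
  have hgood : pr (fun ω => ¬ Good ω x) ≤ δ := by
    refine le_trans ?_ hδ
    calc pr (fun ω => ¬ Good ω x) ≤ pr (fun ω => ∃ a ∈ range (J + 1) ×ˢ range (m + 1),
          ¬ H.GoodAt (3 * P) (2 * P * (n : ℝ) ^ (1 - 2 / p)) (κ * P / 4) η x
            (ρ ^ a.1 / ρ) a.2 ω) := by
          apply pr_mono
          intro ω h
          simp only [hGood] at h
          push Not at h
          obtain ⟨j, hj, s, hs, h⟩ := h
          exact ⟨(j, s), by simp only [mem_product, mem_range]; omega, h⟩
      _ ≤ ∑ a ∈ range (J + 1) ×ˢ range (m + 1),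
          (3 * P / (κ * P / 4) ^ 2 + 1 / lam + n * (1 / 2) ^ R) := by
          refine (pr_exists_le _ _).trans (sum_le_sum fun a ha => ?_)
          simp only [mem_product, mem_range] at ha
          exact H.pr_not_goodAt_le (by positivity) (by positivity) (by positivity) hη hlam hb x
            (by positivity) (by omega)
      _ = _ := by simp; ring
  rw [pr_not] at hgood
  refine le_trans (by linarith) (pr_mono (E := fun ω => Good ω x) fun ω hω => ?_)
  have hex : Ex ω ((H.matrix ω).mulVec x) := ⟨x, hx, hω, rfl⟩
  rw [dif_pos hex]
  obtain ⟨hy1, hy2, hy3⟩ := hex.choose_spec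
  set y := hex.choose
  have hp0 : 0 < p := by linarith
  refine trimmed_close hp0 hρ hκ.le hk (fun i => (hx i).trans_lt hJ)
    (fun i => (hy1 i).trans_lt hJ) ?_ hε0 hε1 hρε hκε
  intro G hG hGx hGy hor
  -- Only values of `G` equal to one of the two scales occur, and these are bounded because both
  -- vectors are; hence a suitable level up to `m` always exists.
  have hGm : G ≤ 2 ^ m := by
    rcases hor with h | h
    · rw [← h]; exact (trimmedScale_le x hp0.le hMx hx hk).trans hm
    · rw [← h]; exact (trimmedScale_le y hp0.le hMx hy1 hk).trans hm
  exact ⟨H.countsLe_of_goodAt hp hρ hρ2 hηρ hκ hP hk hG hGm hGx hGy hy3.symm hω hy2,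
    H.countsLe_of_goodAt hp hρ hρ2 hηρ hκ hP hk hG hGm hGy hGx hy3 hy2 hω⟩

end Construction

/-! ### Choice of parameters, with degrees in `log n / ε` independent of `p`, `γ` and `δ`. -/

section Parameters

/-- `f n ε` is at most a constant times `(log₂ n / ε) ^ d`. -/
def PolyBounded (d : ℕ) (f : ℕ → ℝ → ℝ) : Prop :=
  ∃ C, ∀ n ε, 2 ≤ n → 0 < ε → ε < 1 → |f n ε| ≤ C * (Real.logb 2 n / ε) ^ d

theorem one_le_logb {n : ℕ} (hn : 2 ≤ n) : 1 ≤ Real.logb 2 n := by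
  rw [Real.le_logb_iff_rpow_le (by norm_num) (by positivity), Real.rpow_one]
  exact_mod_cast hn

theorem one_le_logb_div {n : ℕ} {ε : ℝ} (hn : 2 ≤ n) (h0 : 0 < ε) (h1 : ε < 1) :
    1 ≤ Real.logb 2 n / ε := by
  rw [one_le_div h0]; linarith [one_le_logb hn]

namespace PolyBounded

variable {d e : ℕ} {f g : ℕ → ℝ → ℝ}

theorem const (c : ℝ) : PolyBounded 0 fun _ _ => c := ⟨|c|, by simp⟩

theorem logb : PolyBounded 1 fun n _ => Real.logb 2 n :=
  ⟨1, fun n ε hn h0 h1 => by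
    have := one_le_logb hn
    rw [abs_of_nonneg (by linarith), one_mul, pow_one, le_div_iff₀ h0]
    nlinarith⟩

theorem inv : PolyBounded 1 fun _ ε => 1 / ε :=
  ⟨1, fun n ε hn h0 h1 => by
    rw [abs_of_nonneg (by positivity), one_mul, pow_one]
    exact (div_le_div_iff_of_pos_right h0).2 (one_le_logb hn)⟩

theorem mono (hf : PolyBounded d f) (h : d ≤ e) : PolyBounded e f := by
  obtain ⟨C, hC⟩ := hf
  refine ⟨C, fun n ε hn h0 h1 => (hC n ε hn h0 h1).trans ?_⟩
  have hL := one_le_logb_div hn h0 h1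
  have hC0 : 0 ≤ C := by
    have := (abs_nonneg _).trans (hC n ε hn h0 h1)
    exact nonneg_of_mul_nonneg_left this (by positivity)
  gcongr

theorem add (hf : PolyBounded d f) (hg : PolyBounded e g) :
    PolyBounded (max d e) fun n ε => f n ε + g n ε := by
  obtain ⟨C, hC⟩ := hf.mono (le_max_left d e)
  obtain ⟨C', hC'⟩ := hg.mono (le_max_right d e)
  refine ⟨C + C', fun n ε hn h0 h1 => (abs_add_le _ _).trans ?_⟩
  rw [add_mul]
  exact add_le_add (hC n ε hn h0 h1) (hC' n ε hn h0 h1)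

theorem mul (hf : PolyBounded d f) (hg : PolyBounded e g) :
    PolyBounded (d + e) fun n ε => f n ε * g n ε := by
  obtain ⟨C, hC⟩ := hf
  obtain ⟨C', hC'⟩ := hg
  refine ⟨C * C', fun n ε hn h0 h1 => ?_⟩
  rw [abs_mul, pow_add, mul_mul_mul_comm]
  exact mul_le_mul (hC n ε hn h0 h1) (hC' n ε hn h0 h1) (abs_nonneg _)
    ((abs_nonneg _).trans (hC n ε hn h0 h1))

theorem congr (hf : PolyBounded d f) (h : ∀ n ε, g n ε = f n ε) : PolyBounded d g := by
  obtain ⟨C, hC⟩ := hf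
  exact ⟨C, fun n ε hn h0 h1 => by rw [h]; exact hC n ε hn h0 h1⟩

theorem natCeil (hf : PolyBounded d f) : PolyBounded d fun n ε => (⌈f n ε⌉₊ : ℝ) := by
  obtain ⟨D, hD⟩ := hf
  refine ⟨D + 1, fun n ε hn h0 h1 => ?_⟩
  have h2 := hD n ε hn h0 h1
  have h3 : (1 : ℝ) ≤ (Real.logb 2 n / ε) ^ d := one_le_pow₀ (one_le_logb_div hn h0 h1)
  rw [abs_of_nonneg (Nat.cast_nonneg _), add_mul, one_mul]
  have h4 : (⌈f n ε⌉₊ : ℝ) ≤ |f n ε| + 1 := by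
    rcases le_total (f n ε) 0 with h | h
    · rw [Nat.ceil_eq_zero.2 h]
      have := abs_nonneg (f n ε)
      push_cast; linarith
    · rw [abs_of_nonneg h]
      exact (Nat.ceil_lt_add_one h).le
  linarith

end PolyBounded

variable (p g δ : ℝ) (n : ℕ) (ε : ℝ)

/-- The number of thresholds. -/
noncomputable def numThresholds : ℕ := ⌈128 * p * (1 / ε)⌉₊ * ⌈g * Real.logb 2 n + 1⌉₊

/-- The largest sampling level. -/
noncomputable def numLevels : ℕ := ⌈(1 + g * p) * Real.logb 2 n⌉₊

/-- The number of pairs of a threshold and a level. -/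
noncomputable def numTests : ℝ := (numThresholds p g n ε + 1) * (numLevels p g n + 1)

/-- The number of sampled coordinates of a relevant size. -/
noncomputable def sampleSize : ℝ :=
  144 / δ * numTests p g n ε * (64 * numThresholds p g n ε * (1 / ε)) ^ 2

/-- The number of repetitions. -/
noncomputable def numReps : ℕ := ⌈3 / δ * numTests p g n ε⌉₊ + ⌈Real.logb 2 n⌉₊

/-- The number of buckets divided by `n ^ (1 - 2 / p)`. -/
noncomputable def bucketFactor : ℝ :=
  16 * sampleSize p g δ n ε * (4 + 6 / δ * numTests p g n ε * (512 * p * (1 / ε)) ^ 2)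

/-- The number of bits of a counter. -/
noncomputable def counterBits : ℕ := ⌈(1 + g) * Real.logb 2 n + 2⌉₊

theorem polyBounded_numThresholds : PolyBounded 2 fun n ε => (numThresholds p g n ε : ℝ) := by
  have h1 : PolyBounded 1 fun (_ : ℕ) ε => 128 * p * (1 / ε) :=
    (PolyBounded.const (128 * p)).mul PolyBounded.inv
  have h2 : PolyBounded 1 fun n (_ : ℝ) => g * Real.logb 2 n + 1 :=
    ((PolyBounded.const g).mul PolyBounded.logb).add (PolyBounded.const 1)
  simpa [numThresholds] using h1.natCeil.mul h2.natCeil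

theorem polyBounded_numLevels : PolyBounded 1 fun n _ => (numLevels p g n : ℝ) :=
  ((PolyBounded.const (1 + g * p)).mul PolyBounded.logb).natCeil

theorem polyBounded_numTests : PolyBounded 3 (numTests p g) :=
  ((polyBounded_numThresholds p g).add (PolyBounded.const 1)).mul
    ((polyBounded_numLevels p g).add (PolyBounded.const 1))

theorem polyBounded_sampleSize : PolyBounded 9 (sampleSize p g δ) := by
  have h1 : PolyBounded 3 fun n ε => 64 * (numThresholds p g n ε : ℝ) * (1 / ε) :=
    ((PolyBounded.const 64).mul (polyBounded_numThresholds p g)).mul PolyBounded.inv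
  have h2 : PolyBounded 9 _ :=
    ((PolyBounded.const (144 / δ)).mul (polyBounded_numTests p g)).mul (h1.mul h1)
  exact h2.congr fun n ε => by rw [sampleSize, sq]

theorem polyBounded_numReps : PolyBounded 3 fun n ε => (numReps p g δ n ε : ℝ) := by
  have h : PolyBounded 3 _ :=
    ((PolyBounded.const (3 / δ)).mul (polyBounded_numTests p g)).natCeil.add
      PolyBounded.logb.natCeil
  exact h.congr fun n ε => by rw [numReps, Nat.cast_add]

theorem polyBounded_bucketFactor : PolyBounded 14 (bucketFactor p g δ) := by
  have h1 : PolyBounded 1 fun (_ : ℕ) ε => 512 * p * (1 / ε) :=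
    (PolyBounded.const (512 * p)).mul PolyBounded.inv
  have h2 : PolyBounded 14 _ :=
    ((PolyBounded.const 16).mul (polyBounded_sampleSize p g δ)).mul
    ((PolyBounded.const 4).add
      (((PolyBounded.const (6 / δ)).mul (polyBounded_numTests p g)).mul (h1.mul h1)))
  exact h2.congr fun n ε => by rw [bucketFactor, sq]

theorem polyBounded_counterBits : PolyBounded 1 fun n _ => (counterBits g n : ℝ) :=
  (((PolyBounded.const (1 + g)).mul PolyBounded.logb).add (PolyBounded.const 2)).natCeil

/-- The space of the sketch divided by `n ^ (1 - 2 / p)`. -/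
noncomputable def spaceFactor : ℝ :=
  (numLevels p g n + 2 * bucketFactor p g δ n ε + ⌈Real.logb 2 n⌉₊ + 1) *
    (2 + 4 * numReps p g δ n ε) +
  (numLevels p g n + 1) * numReps p g δ n ε * (2 * bucketFactor p g δ n ε) * counterBits g n

theorem polyBounded_spaceFactor : PolyBounded 19 (spaceFactor p g δ) := by
  have hY := (PolyBounded.const 2).mul (polyBounded_bucketFactor p g δ)
  have h1 := ((((polyBounded_numLevels p g).add hY).add PolyBounded.logb.natCeil).add
    (PolyBounded.const 1)).mul
    ((PolyBounded.const 2).add ((PolyBounded.const 4).mul (polyBounded_numReps p g δ)))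
  have h2 := ((((polyBounded_numLevels p g).add (PolyBounded.const 1)).mul
    (polyBounded_numReps p g δ)).mul hY).mul (polyBounded_counterBits g)
  exact h1.add h2

variable {p g δ n ε}

theorem le_two_pow_natCeil_logb (hn : 1 ≤ n) {a : ℝ} :
    (n : ℝ) ^ a ≤ 2 ^ ⌈a * Real.logb 2 n⌉₊ := by
  have hn0 : (0 : ℝ) < n := by exact_mod_cast hn
  calc (n : ℝ) ^ a = (2 : ℝ) ^ (a * Real.logb 2 n) := by
        rw [mul_comm, Real.rpow_mul (by norm_num), Real.rpow_logb (by norm_num) (by norm_num) hn0]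
    _ ≤ (2 : ℝ) ^ ((⌈a * Real.logb 2 n⌉₊ : ℕ) : ℝ) :=
        Real.rpow_le_rpow_of_exponent_le (by norm_num) (Nat.le_ceil _)
    _ = _ := Real.rpow_natCast _ _

theorem two_le_one_add_pow {t : ℝ} (ht : 0 < t) {N : ℕ} (hN : 1 / t ≤ N) : 2 ≤ (1 + t) ^ N := by
  have h1 := one_add_mul_le_pow (a := t) (by linarith) N
  rw [div_le_iff₀ ht] at hN
  linarith

theorem one_add_rpow_sq_le (hp : 0 < p) (h0 : 0 < ε) (h1 : ε < 1) :
    ((1 + ε / (128 * p)) ^ p) ^ 2 ≤ 1 + ε / 32 := by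
  have hpos : 0 < ε / (128 * p) := by positivity
  have h2 : (1 + ε / (128 * p)) ^ p ≤ Real.exp (ε / 128) := by
    calc (1 + ε / (128 * p)) ^ p ≤ (Real.exp (ε / (128 * p))) ^ p := by
          apply Real.rpow_le_rpow (by positivity) _ hp.le
          linarith [Real.add_one_le_exp (ε / (128 * p))]
      _ = Real.exp (ε / 128) := by
          rw [← Real.exp_mul]; congr 1; field_simp
  have h3 : Real.exp (ε / 128) ^ 2 = Real.exp (ε / 64) := by
    rw [← Real.exp_nat_mul]; congr 1; push_cast; ring
  have h4 : Real.exp (ε / 64) ≤ 1 + ε / 32 := by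
    have := Real.abs_exp_sub_one_le (x := ε / 64) (by rw [abs_of_pos (by positivity)]; linarith)
    rw [abs_of_pos (a := ε / 64) (by positivity)] at this
    linarith [(abs_le.1 this).2]
  calc _ ≤ Real.exp (ε / 128) ^ 2 := by gcongr
    _ ≤ _ := by rw [h3]; exact h4

theorem one_le_numThresholds (hp : 2 < p) (h0 : 0 < ε) (hg : 0 ≤ g) (hn : 2 ≤ n) :
    1 ≤ numThresholds p g n ε := by
  have := one_le_logb hn
  exact Nat.mul_pos (Nat.ceil_pos.2 (by positivity)) (Nat.ceil_pos.2 (by positivity))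

/-- By Bernoulli's inequality the first factor of `numThresholds` is a number of steps over which
the powers of `ρ` at least double; the second is the number of doublings needed to pass `n^g`. -/
theorem rpow_lt_pow_numThresholds (hp : 2 < p) (h0 : 0 < ε) (hg : 0 ≤ g) (hn : 2 ≤ n) :
    (n : ℝ) ^ g < (1 + ε / (128 * p)) ^ numThresholds p g n ε := by
  have hn0 : (0 : ℝ) < n := by positivity
  have hl := one_le_logb hn
  have h1 : (2 : ℝ) ≤ (1 + ε / (128 * p)) ^ ⌈128 * p * (1 / ε)⌉₊ := by
    apply two_le_one_add_pow (by positivity)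
    refine le_trans (le_of_eq ?_) (Nat.le_ceil _)
    field_simp
  calc (n : ℝ) ^ g < 2 * 2 ^ ⌈g * Real.logb 2 n⌉₊ := by
        have := le_two_pow_natCeil_logb (a := g) (by omega : 1 ≤ n)
        have h2 : (0 : ℝ) < 2 ^ ⌈g * Real.logb 2 n⌉₊ := by positivity
        linarith
    _ = 2 ^ ⌈g * Real.logb 2 n + 1⌉₊ := by
        rw [Nat.ceil_add_one (by positivity), pow_succ']
    _ ≤ ((1 + ε / (128 * p)) ^ ⌈128 * p * (1 / ε)⌉₊) ^ ⌈g * Real.logb 2 n + 1⌉₊ := by gcongr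
    _ = _ := by rw [numThresholds, pow_mul]

theorem one_le_numTests : 1 ≤ numTests p g n ε := by
  rw [numTests]
  have h1 : (0 : ℝ) ≤ numThresholds p g n ε := Nat.cast_nonneg _
  have h2 : (0 : ℝ) ≤ numLevels p g n := Nat.cast_nonneg _
  nlinarith

theorem mul_half_pow_numReps_le (hδ : 0 < δ) (hn : 2 ≤ n) :
    n * (1 / 2 : ℝ) ^ numReps p g δ n ε ≤ δ / (3 * numTests p g n ε) := by
  have hK : 1 ≤ numTests p g n ε := one_le_numTests
  set K := numTests p g n ε with hKdef
  have h1 : (n : ℝ) ≤ 2 ^ ⌈Real.logb 2 n⌉₊ := by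
    simpa using le_two_pow_natCeil_logb (a := 1) (by omega : 1 ≤ n)
  have h2 : 3 / δ * K ≤ 2 ^ ⌈3 / δ * K⌉₊ := by
    refine (Nat.le_ceil _).trans ?_
    exact_mod_cast Nat.lt_two_pow_self.le
  rw [numReps, ← hKdef, one_div, inv_pow, ← div_eq_mul_inv, div_le_div_iff₀ (by positivity)
    (by positivity)]
  have h3 : 3 * K ≤ 2 ^ ⌈3 / δ * K⌉₊ * δ := by
    rw [← div_le_iff₀ hδ, ← div_mul_eq_mul_div]; exact h2
  rw [pow_add]
  calc (n : ℝ) * (3 * K) ≤ 2 ^ ⌈Real.logb 2 n⌉₊ * (2 ^ ⌈3 / δ * K⌉₊ * δ) :=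
        mul_le_mul h1 h3 (by positivity) (by positivity)
    _ = _ := by ring

/-- With `K` tests, `P = 144 K / (δ κ²)` makes the Chebyshev term exactly `δ / (3K)`, so each of the
three causes of failure takes a third of `δ`. -/
theorem failure_sum_le {K κ P r : ℝ} (hδ : 0 < δ) (hK : 0 < K) (hκ : 0 < κ) (hP : 0 < P)
    (h : P * κ ^ 2 * δ = 144 * K) (hr : r ≤ δ / (3 * K)) :
    K * (3 * P / (κ * P / 4) ^ 2 + 1 / (3 / δ * K) + r) ≤ δ := by
  have e1 : 3 * P / (κ * P / 4) ^ 2 = δ / (3 * K) := by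
    rw [div_eq_div_iff (by positivity) (by positivity)]
    linear_combination (-P / 16) * h
  have e2 : 1 / (3 / δ * K) = δ / (3 * K) := by field_simp
  rw [e1, e2]
  calc _ ≤ K * (δ / (3 * K) + δ / (3 * K) + δ / (3 * K)) := by gcongr
    _ = δ := by field_simp; norm_num

theorem bucket_load_le {K κ P η N b : ℝ} (hδ : 0 < δ) (hκ1 : κ ≤ 1) (hP : 0 < P) (hη : 0 < η)
    (hN : 1 ≤ N) (hb : 0 < b)
    (h : 16 * P * (4 + 6 / δ * K * (1 / η) ^ 2) * N ≤ b) :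
    (3 * P + κ * P / 4) / b + 3 / δ * K * (2 * P * N) / (b * η ^ 2) ≤ 1 / 16 := by
  have e1 : 3 * P + κ * P / 4 ≤ 4 * P * N := by nlinarith
  have e2 : 3 / δ * K * (2 * P * N) / (b * η ^ 2) = P * (6 / δ * K * (1 / η) ^ 2) * N / b := by
    field_simp; ring
  rw [e2, ← add_div, div_le_iff₀ hb]
  linarith

theorem exists_sketch_main {γ : ℝ} {k : ℕ} (hp : 2 < p) (hδ0 : 0 < δ) (hδ1 : δ < 1) (hn : 2 ≤ n)
    (hk : 2 * k ≤ n) (hε0 : 0 < ε) (hε1 : ε < 1) (hg : 0 ≤ g) (hγ : γ ≤ g) :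
    ∃ S : LinearSketch n,
      (S.space : ℝ) ≤ spaceFactor p g δ n ε * (n : ℝ) ^ (1 - 2 / p) ∧ S.NoOverflow ((n : ℝ) ^ γ) ∧
      ∀ x : Fin n → ℤ, (∀ i, |(x i : ℝ)| ≤ (n : ℝ) ^ γ) →
        1 - δ ≤ S.probWithin x (trimmedMoment x p k)
          (ε * (trimmedMoment x p k + k * rankedFreq x ⌈(k : ℝ) - ε * k⌉₊ ^ p)) := by
  have hp0 : 0 < p := by linarith
  have hn1 : (1 : ℝ) ≤ n := by exact_mod_cast (by omega : 1 ≤ n)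
  have hMx : (n : ℝ) ^ γ ≤ (n : ℝ) ^ g := Real.rpow_le_rpow_of_exponent_le hn1 hγ
  set J := numThresholds p g n ε with hJ
  set m := numLevels p g n with hm
  set K := numTests p g n ε with hK
  set P := sampleSize p g δ n ε with hP
  set R := numReps p g δ n ε with hR
  set Y := bucketFactor p g δ n ε with hY
  set N := (n : ℝ) ^ (1 - 2 / p) with hN
  have hKJ : (J + 1 : ℝ) * (m + 1) = K := rfl
  have hK1 : 1 ≤ K := one_le_numTests
  have hJ1 : (1 : ℝ) ≤ J := by exact_mod_cast one_le_numThresholds hp hε0 hg hn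
  -- The total counting error over all `J` thresholds is then `ε / 64`.
  set κ := ε / (64 * J) with hκ
  have hκ0 : 0 < κ := by positivity
  have hκ1 : κ ≤ 1 := by rw [hκ, div_le_one (by positivity)]; linarith
  have hPκ : P = 144 / δ * K / κ ^ 2 := by
    rw [hP, sampleSize, ← hK, ← hJ, hκ]; field_simp
  have hPκ' : P * κ ^ 2 * δ = 144 * K := by rw [hPκ]; field_simp
  have hP1 : 1 ≤ P := by
    rw [hPκ, one_le_div (by positivity)]
    refine (pow_le_one₀ hκ0.le hκ1).trans (one_le_mul_of_one_le_of_one_le ?_ hK1)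
    rw [one_le_div hδ0]
    linarith
  -- This gives `ρ = 1 + 4η`, and `1 / ρ ≤ 1 - 2η` follows from `η ≤ 1/4`.
  set η := ε / (512 * p) with hη
  have hη0 : 0 < η := by positivity
  set ρ := 1 + ε / (128 * p) with hρ
  have hρη : ρ = 1 + 4 * η := by rw [hρ, hη]; field_simp; ring
  have hη1 : η ≤ 1 / 4 := by
    rw [hη, div_le_div_iff₀ (by positivity) (by norm_num)]; linarith
  have hRtail : n * (1 / 2 : ℝ) ^ R ≤ δ / (3 * K) := mul_half_pow_numReps_le hδ0 hn
  have hJρ : (n : ℝ) ^ g < ρ ^ J := rpow_lt_pow_numThresholds hp hε0 hg hn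
  have hρε : (ρ ^ p) ^ 2 ≤ 1 + ε / 32 := one_add_rpow_sq_le hp0 hε0 hε1
  have hspace : spaceFactor p g δ n ε = (m + 2 * Y + ⌈Real.logb 2 n⌉₊ + 1) * (2 + 4 * R) +
    (m + 1) * R * (2 * Y) * counterBits g n := rfl
  have hκJ : J * κ ≤ ε / 64 := by rw [hκ]; apply le_of_eq; field_simp
  have hN1 : 1 ≤ N := by
    apply Real.one_le_rpow hn1
    rw [sub_nonneg, div_le_one hp0]; exact hp.le
  have hYdef : Y = 16 * P * (4 + 6 / δ * K * (1 / η) ^ 2) := by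
    rw [hY, bucketFactor, ← hK, ← hP, hη]
    congr 4; field_simp
  have hY1 : 1 ≤ Y := by
    rw [hYdef]
    have : 0 ≤ 6 / δ * K * (1 / η) ^ 2 := by positivity
    exact one_le_mul_of_one_le_of_one_le (by linarith) (by linarith)
  have hYN1 : 1 ≤ Y * N := one_le_mul_of_one_le_of_one_le hY1 hN1
  -- The number of buckets is a power of two between `Y N` and `2 Y N`.
  obtain ⟨β, hβ1, hβ2⟩ := exists_nat_pow_near (x := 2 * (Y * N)) (y := 2) (by linarith)
    (by norm_num)
  rw [pow_succ] at hβ2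
  have hYb : Y * N ≤ 2 ^ β := by linarith
  have hlog : (n : ℝ) ≤ 2 ^ ⌈Real.logb 2 n⌉₊ := by
    simpa using le_two_pow_natCeil_logb (a := 1) (by omega : 1 ≤ n)
  set ℓ := ⌈Real.logb 2 n⌉₊
  obtain ⟨F, _, _, hF, ⟨H⟩⟩ := exists_hashSystem (n := n) (m := m) (β := β) (q := m + β + ℓ + 1)
    (by
      have : n ≤ 2 ^ ℓ := by exact_mod_cast hlog
      exact this.trans (Nat.pow_le_pow_right (by norm_num) (by omega)))
    (by omega) (by omega) (by omega)
  have hw : 2 * (n * (n : ℝ) ^ γ) < 2 ^ counterBits g n := by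
    have h1 := le_two_pow_natCeil_logb (n := n) (a := 1 + g) (by omega)
    have h2 : counterBits g n = ⌈(1 + g) * Real.logb 2 n⌉₊ + 2 := by
      have := one_le_logb hn
      exact Nat.ceil_add_ofNat (by positivity) 2
    rw [h2, pow_add]
    have h3 : (n : ℝ) * (n : ℝ) ^ γ ≤ (n : ℝ) ^ (1 + g) := by
      rw [Real.rpow_add (by linarith), Real.rpow_one]; gcongr
    have h4 : (0 : ℝ) < 2 ^ ⌈(1 + g) * Real.logb 2 n⌉₊ := by positivity
    linarith
  have hmG : n * ((n : ℝ) ^ γ) ^ p ≤ 2 ^ m := by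
    refine le_trans ?_ (le_two_pow_natCeil_logb (n := n) (a := 1 + g * p) (by omega))
    rw [Real.rpow_add (by linarith), Real.rpow_one, Real.rpow_mul (by linarith)]
    gcongr
  clear_value J m K P R Y κ η ρ
  obtain ⟨S, hS1, hS2, hS3⟩ := H.exists_sketch hF (k := k) (J := J) (R := R)
    (w := counterBits g n) (p := p) (ρ := ρ) (κ := κ) (η := η) (P := P) (lam := 3 / δ * K) (δ := δ)
    (ε := ε) (Mx := (n : ℝ) ^ γ) hp
    (by rw [hρη]; linarith) hη0
    (by rw [hρη, div_le_iff₀ (by linarith)]; nlinarith only [hη0, hη1]) hκ0 hP1 (by positivity) (by omega) hk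
    (by positivity) (hMx.trans_lt hJρ) hmG hw hε0 hε1 hρε hκJ
    (by
      rw [hYdef] at hYb
      push_cast
      exact bucket_load_le hδ0 hκ1 (by linarith) hη0 hN1 (by positivity) hYb)
    (by
      rw [hKJ]
      exact failure_sum_le hδ0 (by linarith) hκ0 (by linarith) hPκ' hRtail)
  refine ⟨S, ?_, hS2, hS3⟩
  rw [hS1, hspace]
  push_cast
  have hβb : (β : ℝ) ≤ 2 ^ β := by exact_mod_cast Nat.lt_two_pow_self.le
  have q1 : (m : ℝ) + β + ℓ + 1 ≤ (m + 2 * Y + ℓ + 1) * N := by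
    have : (β : ℝ) ≤ 2 * Y * N := by linarith
    have h1 : (m : ℝ) + ℓ + 1 ≤ (m + ℓ + 1) * N := le_mul_of_one_le_right (by positivity) hN1
    linarith
  have q2 : (2 : ℝ) ^ β ≤ 2 * Y * N := by linarith
  calc 2 * ((m : ℝ) + β + ℓ + 1) + 4 * (m + β + ℓ + 1) * R + (m + 1) * R * 2 ^ β * counterBits g n
      = (m + β + ℓ + 1) * (2 + 4 * R) + (m + 1) * R * 2 ^ β * counterBits g n := by ring
    _ ≤ (m + 2 * Y + ℓ + 1) * N * (2 + 4 * R) + (m + 1) * R * (2 * Y * N) * counterBits g n := by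
        gcongr
    _ = _ := by ring

end Parameters

/-! ### The main theorem. -/

theorem theorem6 (c : ℝ) :
    ∃ B : ℝ, ∀ p γ δ : ℝ, 2 < p → 0 < δ → δ < 1 →
      ∃ A : ℝ, ∀ (n k : ℕ) (ε : ℝ), 2 ≤ n → k ≤ n → 0 < ε → ε < 1 →
        ∃ S : LinearSketch n,
          (S.space : ℝ) ≤ A * (Real.logb 2 n / ε) ^ B * (n : ℝ) ^ (1 - 2 / p) ∧
          S.NoOverflow ((n : ℝ) ^ γ) ∧
          ∀ x : Fin n → ℤ, (∀ i, |(x i : ℝ)| ≤ (n : ℝ) ^ γ) →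
            (1 ≤ k →
              rankedFreq x k ^ p ≥ (ε / Real.logb 2 n) ^ c * (tailMoment x p k / k)) →
            1 - δ ≤ S.probWithin x (trimmedMoment x p k)
              (ε * (trimmedMoment x p k + k * rankedFreq x ⌈(k : ℝ) - ε * k⌉₊ ^ p)) := by
  -- The dominant cost is levels times repetitions times buckets times counter bits, of degrees `1 +
  -- 3 + 14 + 1`.
  refine ⟨((19 : ℕ) : ℝ), fun p γ δ hp hδ0 hδ1 => ?_⟩
  obtain ⟨A, hA⟩ := polyBounded_spaceFactor p (max γ 0) δ
  refine ⟨A, fun n k ε hn _ hε0 hε1 => ?_⟩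
  have hspace : spaceFactor p (max γ 0) δ n ε ≤ A * (Real.logb 2 n / ε) ^ 19 :=
    (le_abs_self _).trans (hA n ε hn hε0 hε1)
  have hspace0 : 0 ≤ A * (Real.logb 2 n / ε) ^ 19 := (abs_nonneg _).trans (hA n ε hn hε0 hε1)
  rw [Real.rpow_natCast]
  by_cases hk : 2 * k ≤ n
  · obtain ⟨S, hS1, hS2, hS3⟩ := exists_sketch_main (γ := γ) hp hδ0 hδ1 hn hk hε0 hε1
      (le_max_right γ 0) (le_max_left γ 0)
    exact ⟨S, hS1.trans (by gcongr), hS2, fun x hx _ => hS3 x hx⟩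
  -- For `2k > n` the sketch with no rows and no seed that always answers `0` is exact.
  · obtain ⟨w, hw⟩ := pow_unbounded_of_one_lt (2 * (n * (n : ℝ) ^ γ)) (one_lt_two (α := ℝ))
    obtain ⟨S, hS1, hS2, hS3⟩ := exists_linearSketch (n := n) (Ω := Unit) (T := Empty) (d := 0)
      (by simp) (fun _ t => t.elim) (fun _ t => t.elim) (fun _ _ => 0) hw
    refine ⟨S, ?_, hS2, fun x _ _ => ?_⟩
    · rw [hS1]
      simp only [Fintype.card_empty, zero_mul, add_zero, Nat.cast_zero]
      positivity
    · have hT : trimmedMoment x p k = 0 := by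
        rw [trimmedMoment, Icc_eq_empty (by omega), sum_empty]
      have hQ : 0 ≤ ε * (0 + k * rankedFreq x ⌈(k : ℝ) - ε * k⌉₊ ^ p) :=
        mul_nonneg hε0.le (add_nonneg le_rfl
          (mul_nonneg (Nat.cast_nonneg _) (Real.rpow_nonneg (rankedFreq_nonneg x _) _)))
      rw [hS3, hT]
      simp only [sub_self, abs_zero, hQ]
      simp [pr, hδ0.le]
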